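/- Let $p$ be a prime number and let $R$ be a Noetherian commutative ring of characteristic $p$. For $e \ge 1$ let $F^e_*R$ denote $R$ regarded as an $R$-module via the $e$-th iterate of the Frobenius map, i.e. with the action $r\cdot x = r^{p^e}x$. (If $R$ is a domain, this is the $R$-module $R^{1/p^e}$, with $x \in F^e_*R$ corresponding to $x^{1/p^e}$.) Suppose that $R$ is strongly F-regular, that is: (a) $R$ is F-finite: $R$ is a finitely generated module over its subring $R^p$ of $p$-th powers; and (b) for every $f\in R$ that lies in no minimal prime of $R$ (when $R$ is a domain: for every nonzero $f \in R$) there exist an integer $e\ge 1$ and an $R$-linear map $\varphi\colon F^e_*R\to R$ with $\varphi(f)=1$. Then $R$ is Cohen–Macaulay (for every prime ideal $P$ of $R$, the local ring $R_P$ admits a regular sequence of length $\dim R_P$) and normal (for every prime ideal $P$ of $R$, the local ring $R_P$ is a domain that is integrally closed in its fraction field; when $R$ is a domain, this says that $R$ is integrally closed in its fraction field). -/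

import Mathlib

/-- `F^e_* R`: the ring `R` viewed as an `R`-module by restriction of scalars along the `e`-th
iterate `F^e : R → R`, `r ↦ r ^ p ^ e`, of the Frobenius map.  For a reduced ring `R` it is
the `R`-module `R^{1/p^e}`, the element `x` of `F^e_* R` corresponding to `x^{1/p^e}`. -/
def FrobeniusPushforward (R : Type*) (_p _e : ℕ) : Type _ := R

namespace FrobeniusPushforward

instance instAddCommGroup (R : Type*) [CommRing R] (p e : ℕ) :
    AddCommGroup (FrobeniusPushforward R p e) :=
  inferInstanceAs (AddCommGroup R)

/-- The identity of `R`, as an additive isomorphism from `R` to `F^e_* R`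
(the map `x ↦ x^{1/p^e}` when `R` is reduced). -/
def of (R : Type*) [CommRing R] (p e : ℕ) : R ≃+ FrobeniusPushforward R p e :=
  AddEquiv.refl R

instance instModule (R : Type*) [CommRing R] (p e : ℕ) [Fact p.Prime] [CharP R p] :
    Module R (FrobeniusPushforward R p e) :=
  Module.compHom R (iterateFrobenius R p e)

/-- The scalar action of `R` on `F^e_* R` is `r • x = r ^ p ^ e * x`. -/
theorem smul_of (R : Type*) [CommRing R] (p e : ℕ) [Fact p.Prime] [CharP R p] (r x : R) :
    r • of R p e x = of R p e (r ^ p ^ e * x) := rfl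

end FrobeniusPushforward

/-- A ring of prime characteristic `p` is F-finite if it is a finitely generated module over itself
via the Frobenius map (equivalently, over its subring of `p`-th powers). -/
def IsFFinite (R : Type*) [CommRing R] (p : ℕ) [Fact p.Prime] [CharP R p] : Prop :=
  (frobenius R p).Finite

/-- A ring `R` of prime characteristic `p` is strongly F-regular if it is F-finite and for every `f`
in no minimal prime of `R` (for a domain: for every `f ≠ 0`) there are `e ≥ 1` and an `R`-linear map
`φ : F^e_* R → R` that sends `f`, viewed in `F^e_* R`, to `1`. -/
def IsStronglyFRegular (R : Type*) [CommRing R] (p : ℕ) [Fact p.Prime] [CharP R p] : Prop :=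
  IsFFinite R p ∧
    ∀ f : R, (∀ Q ∈ minimalPrimes R, f ∉ Q) →
      ∃ e : ℕ, 1 ≤ e ∧ ∃ φ : FrobeniusPushforward R p e →ₗ[R] R,
        φ (FrobeniusPushforward.of R p e f) = 1

/-- A (Noetherian) local ring is Cohen-Macaulay if it admits a regular sequence of length equal to
its Krull dimension.  (`IsRegular` includes that the sequence generates a proper ideal.) -/
def IsCohenMacaulayLocalRing (R : Type*) [CommRing R] [IsLocalRing R] : Prop :=
  ∃ rs : List R, RingTheory.Sequence.IsRegular R rs ∧
    (rs.length : WithBot ℕ∞) = ringKrullDim R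

/-- A ring is Cohen-Macaulay if it is Noetherian and all its local rings are Cohen-Macaulay. -/
def IsCohenMacaulayRing (R : Type*) [CommRing R] : Prop :=
  IsNoetherianRing R ∧
    ∀ (P : Ideal R) [P.IsPrime], IsCohenMacaulayLocalRing (Localization.AtPrime P)

/-- A ring is normal if all its local rings are domains that are integrally closed in their
fraction fields (for a domain: if it is integrally closed in its fraction field). -/
def IsNormalRing (R : Type*) [CommRing R] : Prop :=
  ∀ (P : Ideal R) [P.IsPrime],
    IsDomain (Localization.AtPrime P) ∧ IsIntegrallyClosed (Localization.AtPrime P)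

/-!
Strong F-regularity passes to the local rings, in the form that every element outside the minimal
primes is sent to `1` by an additive map `φ` with `φ (r ^ p ^ e * x) = r * φ x`
(`HasCartierSplittings.localization`). So let `A` be a local ring with this property.

Normality. If `c * a ^ p ^ e` is a multiple of `b ^ p ^ e` for all `e`, with a fixed `c` outside the
minimal primes, applying the `φ` that sends `c` to `1` shows that `b` divides `a`. Both the fact
that `A` is a domain and its integral closedness follow from this by a choice of `a`, `b`
and `c`.

The Cohen–Macaulay property is proved by counting lengths, without local duality. Let `A` have
dimension `d`, fraction field `K` and residue field `k`, and put `D = [K : K ^ p]`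
and `α = [k : k ^ p]`.

* There is a single `c ≠ 0` that kills, for every `e`, the cokernel of a linear map from `F^e_* A`
  to a free module of rank `D ^ e` (`IsFFinite.exists_uniform_cartierMap`). Composing with a map
  that sends `c` to `1`, one finds `e₀` such that `F^(e + e₀)_* A` has a free direct summand of rank
  `D ^ e` for every `e` (`HasCartierSplittings.exists_free_quotients`).
* `D ≥ p ^ d * α` (`pow_mul_frobeniusDegree_residueField_le`). This reduces to dimension one, where
  it is read off from the length of `F_* A / x F_* A`, for `x` in the maximal ideal.
* Let `x₁, …, x_k` be a regular sequence with `k < d`, and suppose that the maximal ideal is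
  associated to `A / (x₁, …, x_k)`. Let `q = p ^ (e + e₀)`. The free summand gives at least `D ^ e`
  for the length of the largest submodule of finite length of
  `F^(e + e₀)_* (A / (x₁ ^ q, …, x_k ^ q))`. Filtering by powers of the `x_i`, this length is at
  most `α ^ (e + e₀) * q ^ k` times a constant (`socleLength_quotient_map_pow_le`). For large `e`
  this contradicts `D ≥ p ^ d * α`. Hence every regular sequence of length less than `d` can
  be extended.
-/

open IsLocalRing

/-! ### Restriction of scalars along a ring homomorphism -/

/-- The `R`-module obtained from an `S`-module `M` by restriction of scalars along
`f : R →+* S`. It is a type synonym, so that for `R = S` the two module structures do not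
compete. -/
def RestrictAlong {R S : Type*} [CommRing R] [CommRing S] (_f : R →+* S) (M : Type*) : Type _ := M

namespace RestrictAlong

variable {R S T : Type*} [CommRing R] [CommRing S] [CommRing T] (f : R →+* S)
variable (M N : Type*) [AddCommGroup M] [AddCommGroup N] [Module S M] [Module S N]

instance : AddCommGroup (RestrictAlong f M) := inferInstanceAs (AddCommGroup M)

instance : Module R (RestrictAlong f M) := Module.compHom M f

/-- The identity map from `M` to its restriction of scalars. -/
def of : M ≃+ RestrictAlong f M := AddEquiv.refl M

variable {M N}

theorem smul_of (r : R) (x : M) : r • of f M x = of f M (f r • x) := rfl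

/-- An `S`-linear map, regarded as a map between the restrictions of scalars. -/
def map (g : M →ₗ[S] N) : RestrictAlong f M →ₗ[R] RestrictAlong f N where
  toFun x := of f N (g ((of f M).symm x))
  map_add' _ _ := g.map_add _ _
  map_smul' r x := g.map_smul (f r) ((of f M).symm x)

/-- An `S`-linear equivalence, regarded as an equivalence of the restrictions of scalars. -/
def congr (g : M ≃ₗ[S] N) : RestrictAlong f M ≃ₗ[R] RestrictAlong f N :=
  { map f g.toLinearMap, g.toEquiv with }

/-- Restriction of scalars along a composite, in two steps. -/
def compEquiv (g : S →+* T) (P : Type*) [AddCommGroup P] [Module T P] :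
    RestrictAlong (g.comp f) P ≃ₗ[R] RestrictAlong f (RestrictAlong g P) :=
  { AddEquiv.refl P with map_smul' := fun _ _ => rfl }

end RestrictAlong

open RestrictAlong

/-- The degree of `S` over the ring homomorphism `f : R →+* S`: the length of `S` as an
`R`-module. For fields it is the dimension of `S` over the image of `f`. -/
noncomputable def lengthAlong {R S : Type*} [CommRing R] [CommRing S] (f : R →+* S) : ℕ∞ :=
  Module.length R (RestrictAlong f S)

/-- Over a field, length along a homomorphism of fields is multiplied by the degree. -/
theorem length_restrictAlong_field {K L : Type*} [Field K] [Field L] (f : K →+* L)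
    (M : Type*) [AddCommGroup M] [Module L M] :
    Module.length K (RestrictAlong f M) = Module.length L M * lengthAlong f := by
  let b := Module.Free.chooseBasis L M
  let e : RestrictAlong f (Module.Free.ChooseBasisIndex L M →₀ L) ≃ₗ[K]
      (Module.Free.ChooseBasisIndex L M →₀ RestrictAlong f L) :=
    { AddEquiv.refl (Module.Free.ChooseBasisIndex L M →₀ L) with map_smul' := fun _ _ => rfl }
  rw [((RestrictAlong.congr f b.repr).trans e).length_eq, Module.length_finsupp,
    b.repr.length_eq, Module.length_finsupp, Module.length_eq_one L L, mul_one, lengthAlong]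

theorem lengthAlong_comp {K L M : Type*} [Field K] [Field L] [Field M] (f : K →+* L)
    (g : L →+* M) : lengthAlong (g.comp f) = lengthAlong g * lengthAlong f := by
  rw [lengthAlong, (compEquiv f g M).length_eq, length_restrictAlong_field]
  rfl

/-- Length of a restriction of scalars along a local homomorphism is multiplied by the degree of
the residue field extension. -/
theorem length_restrictAlong {R S : Type*} [CommRing R] [CommRing S] [IsLocalRing R]
    [IsLocalRing S] (f : R →+* S) [IsLocalHom f] (M : Type*) [AddCommGroup M] [Module S M] :
    Module.length R (RestrictAlong f M) =
      Module.length S M * lengthAlong (ResidueField.map f) := by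
  let : Algebra R S := f.toAlgebra
  have : IsLocalHom (algebraMap R S) := ‹IsLocalHom f›
  let : Module S (RestrictAlong f M) := inferInstanceAs (Module S M)
  have : IsScalarTower R S (RestrictAlong f M) := ⟨fun r s x => mul_smul (f r) s (x : M)⟩
  have h := IsLocalRing.length_restrictScalars R S (RestrictAlong f M)
  have e : RestrictAlong (ResidueField.map f) (ResidueField S) ≃ₗ[ResidueField R]
      ResidueField S :=
    { AddEquiv.refl (ResidueField S) with
      map_smul' := fun r x => (Algebra.smul_def r (show ResidueField S from x)).symm }
  rw [h, lengthAlong, e.length_eq]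
  rfl

/-- The degree of an endomorphism of a field is invariant under isomorphisms of fields. -/
theorem lengthAlong_eq_of_ringEquiv {K L : Type*} [Field K] [Field L] (f : K →+* K) (g : L →+* L)
    (e : K ≃+* L) (h : ∀ x, e (f x) = g (e x)) : lengthAlong f = lengthAlong g := by
  have h1 : (e : K →+* L).comp f = g.comp (e : K →+* L) := RingHom.ext h
  have h2 := lengthAlong_comp f (e : K →+* L)
  rw [h1, lengthAlong_comp] at h2
  have h3 : lengthAlong (e : K →+* L) = 1 := by
    let := (e : K →+* L).toAlgebra
    have h4 := Module.length_eq_of_surjective (R := L) (S := K) (M := L) e.surjective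
    rw [Module.length_eq_one L L] at h4
    exact h4
  rw [h3, one_mul, mul_one] at h2
  exact h2.symm

/-! ### The supremum of the lengths of the submodules of finite length -/

/-- The supremum of the lengths of the submodules of finite length of `M`. For a finitely generated
module over a Noetherian local ring it is the length of the zeroth local cohomology
module `H⁰_𝔪(M)`. -/
noncomputable def socleLength (R M : Type*) [CommRing R] [AddCommGroup M] [Module R M] : ℕ∞ :=
  ⨆ (N : Submodule R M) (_ : Module.length R N ≠ ⊤), Module.length R N

section SocleLength

variable {R : Type*} [CommRing R] {A B C : Type*} [AddCommGroup A] [Module R A]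
  [AddCommGroup B] [Module R B] [AddCommGroup C] [Module R C]

theorem length_le_socleLength (N : Submodule R A) (h : Module.length R N ≠ ⊤) :
    Module.length R N ≤ socleLength R A :=
  le_iSup₂_of_le N h le_rfl

/-- A module of finite length that embeds into `B` contributes to the supremum. -/
theorem length_le_socleLength_of_injective (f : A →ₗ[R] B) (hf : Function.Injective f)
    (h : Module.length R A ≠ ⊤) : Module.length R A ≤ socleLength R B := by
  rw [(LinearEquiv.ofInjective f hf).length_eq] at h ⊢
  exact length_le_socleLength _ h

theorem socleLength_le_of_injective (f : A →ₗ[R] B) (hf : Function.Injective f) :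
    socleLength R A ≤ socleLength R B :=
  iSup₂_le fun N h => length_le_socleLength_of_injective (f ∘ₗ N.subtype)
    (hf.comp N.injective_subtype) h

theorem LinearEquiv.socleLength_eq (e : A ≃ₗ[R] B) : socleLength R A = socleLength R B :=
  le_antisymm (socleLength_le_of_injective e.toLinearMap e.injective)
    (socleLength_le_of_injective e.symm.toLinearMap e.symm.injective)

theorem socleLength_le_add_of_exact (f : A →ₗ[R] B) (g : B →ₗ[R] C) (hf : Function.Injective f)
    (h : Function.Exact f g) : socleLength R B ≤ socleLength R A + socleLength R C := by
  refine iSup₂_le fun N hN => ?_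
  let g' : N →ₗ[R] C := g ∘ₗ N.subtype
  have h1 := Module.length_eq_add_of_exact (LinearMap.ker g').subtype g'.rangeRestrict
    (Submodule.injective_subtype _) g'.surjective_rangeRestrict (by
      intro x
      simp [LinearMap.mem_ker, Subtype.ext_iff])
  have hk : Module.length R (LinearMap.ker g') ≠ ⊤ := fun ht => hN (by rw [h1, ht, top_add])
  have hr : Module.length R (LinearMap.range g') ≠ ⊤ := fun ht => hN (by rw [h1, ht, add_top])
  rw [h1]
  refine add_le_add ?_ (length_le_socleLength _ hr)
  have hmem : ∀ x : LinearMap.ker g', (x : N).1 ∈ LinearMap.range f := fun x => (h _).1 x.2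
  let k : LinearMap.ker g' →ₗ[R] LinearMap.range f :=
    (N.subtype ∘ₗ (LinearMap.ker g').subtype).codRestrict _ hmem
  have hkinj : Function.Injective k := by
    intro x y hxy
    exact Subtype.ext (Subtype.ext (congrArg (Subtype.val (p := (· ∈ LinearMap.range f))) hxy))
  exact length_le_socleLength_of_injective ((LinearEquiv.ofInjective f hf).symm.toLinearMap ∘ₗ k)
    ((LinearEquiv.ofInjective f hf).symm.injective.comp hkinj) hk

/-- In a Noetherian module there is a largest submodule of finite length. -/
theorem socleLength_ne_top [IsNoetherian R A] : socleLength R A ≠ ⊤ := by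
  obtain ⟨N, hN, hmax⟩ := (wellFounded_gt (α := Submodule R A)).has_min
    {N | Module.length R N ≠ ⊤} ⟨⊥, by simp⟩
  have hle : socleLength R A ≤ Module.length R N := by
    refine iSup₂_le fun N' hN' => ?_
    have hsup : Module.length R ↥(N ⊔ N') ≠ ⊤ := by
      have h1 := IsFiniteLength.of_surjective (Module.length_ne_top_iff.1
        (by rw [Module.length_prod]; exact WithTop.add_ne_top.2 ⟨hN, hN'⟩ :
          Module.length R (N × N') ≠ ⊤))
        (f := (N.subtype.coprod N'.subtype).rangeRestrict) (LinearMap.surjective_rangeRestrict _)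
      rw [LinearMap.range_coprod, Submodule.range_subtype, Submodule.range_subtype] at h1
      exact Module.length_ne_top_iff.2 h1
    have hge : N' ≤ N := by
      by_contra hnot
      exact hmax _ hsup (lt_of_le_of_ne le_sup_left fun heq => hnot (heq ▸ le_sup_right))
    exact Module.length_le_of_injective (Submodule.inclusion hge) (Submodule.inclusion_injective _)
  exact ne_top_of_le_ne_top hN hle

/-- If the maximal ideal is associated to `A`, a finite power of `A` contains as many independent
copies of the residue field as it has factors. -/
theorem natCard_le_socleLength_pi [IsLocalRing R] [IsNoetherianRing R] (ι : Type*) [Fintype ι]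
    (h : maximalIdeal R ∈ associatedPrimes R A) :
    (Fintype.card ι : ℕ∞) ≤ socleLength R (ι → A) := by
  obtain ⟨f, hf⟩ := (isAssociatedPrime_iff_exists_injective_linearMap _ _).1 h |>.2
  have hs : Module.length R (R ⧸ maximalIdeal R) = 1 := by
    rw [Module.length_eq_one_iff, isSimpleModule_iff_quot_maximal]
    exact ⟨_, maximalIdeal.isMaximal R, ⟨LinearEquiv.refl _ _⟩⟩
  have hp : Module.length R (ι → R ⧸ maximalIdeal R) = Fintype.card ι := by
    rw [Module.length_pi, hs, mul_one, ENat.card_eq_coe_fintype_card]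
  rw [← hp]
  exact length_le_socleLength_of_injective (LinearMap.compLeft f ι) (hf.comp_left)
    (by rw [hp]; exact ENat.natCast_ne_top _)

end SocleLength

open RestrictAlong in
/-- Restriction of scalars along a finite local endomorphism multiplies `socleLength` by at most
the degree of the residue field extension. -/
theorem socleLength_restrictAlong_le {R S : Type*} [CommRing R] [CommRing S] [IsLocalRing R]
    [IsLocalRing S] (f : R →+* S) [IsLocalHom f] (hf : f.Finite) (M : Type*)
    [AddCommGroup M] [Module S M] :
    socleLength R (RestrictAlong f M) ≤ socleLength S M * lengthAlong (ResidueField.map f) := by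
  refine iSup₂_le fun N hN => ?_
  -- The `S`-span of `N` is a quotient of a finite power of `N`, hence of finite length.
  let P : Submodule S M := Submodule.span S {x | of f M x ∈ N}
  have hNP : ∀ x : N, (of f M).symm (x : RestrictAlong f M) ∈ P := fun x =>
    Submodule.subset_span x.2
  let j : N →ₗ[R] RestrictAlong f P :=
    { toFun := fun x => of f P ⟨(of f M).symm x, hNP x⟩
      map_add' := fun _ _ => rfl
      map_smul' := fun _ _ => rfl }
  have hj : Function.Injective j := fun x y hxy =>
    Subtype.ext (congrArg (Subtype.val (p := (· ∈ P))) hxy)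
  have hfin : Module.length R (RestrictAlong f P) ≠ ⊤ := by
    let : Algebra R S := f.toAlgebra
    have : Module.Finite R S := hf
    obtain ⟨s, hs⟩ := Module.Finite.fg_top (R := R) (M := S)
    let k : (s → N) →ₗ[R] RestrictAlong f P :=
      ∑ i : s, RestrictAlong.map f (LinearMap.lsmul S P (i : S)) ∘ₗ j ∘ₗ LinearMap.proj i
    have hk : Function.Surjective k := by
      have key1 : ∀ (a : S) (x : N), RestrictAlong.map f (LinearMap.lsmul S P a) (j x) ∈
          LinearMap.range k := by
        intro a x
        have ha : a ∈ Submodule.span R (s : Set S) := hs ▸ Submodule.mem_top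
        induction ha using Submodule.span_induction with
        | mem a ha =>
          classical
          refine ⟨Pi.single ⟨a, ha⟩ x, ?_⟩
          rw [LinearMap.sum_apply, Finset.sum_eq_single ⟨a, ha⟩]
          · simp
          · intro b _ hb
            simp [Pi.single_eq_of_ne hb]
          · simp
        | zero => rw [map_zero]; exact Submodule.zero_mem _
        | add a b _ _ iha ihb => rw [map_add]; exact Submodule.add_mem _ iha ihb
        | smul r a _ ih =>
          have : RestrictAlong.map f (LinearMap.lsmul S P (r • a)) (j x) =
              r • RestrictAlong.map f (LinearMap.lsmul S P a) (j x) :=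
            congrArg (of f P) (mul_smul (f r) a ((of f P).symm (j x)))
          rw [this]
          exact Submodule.smul_mem _ _ ih
      have key2 : ∀ x (hx : x ∈ P) (a : S), of f P (a • ⟨x, hx⟩) ∈ LinearMap.range k := by
        intro x hx
        induction hx using Submodule.span_induction with
        | mem x hx => exact fun a => key1 a ⟨_, hx⟩
        | zero =>
            intro a
            have : of f P (a • ⟨0, P.zero_mem⟩) = 0 :=
              congrArg (of f P) (smul_zero a : a • (0 : P) = 0)
            rw [this]
            exact Submodule.zero_mem _
        | add x y hx hy ihx ihy =>
            intro a
            have : of f P (a • ⟨x + y, P.add_mem hx hy⟩) =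
                of f P (a • ⟨x, hx⟩) + of f P (a • ⟨y, hy⟩) :=
              smul_add a (⟨x, hx⟩ : P) ⟨y, hy⟩
            rw [this]
            exact Submodule.add_mem _ (ihx a) (ihy a)
        | smul b x hx ih =>
            intro a
            have : of f P (a • ⟨b • x, P.smul_mem b hx⟩) = of f P ((a * b) • ⟨x, hx⟩) :=
              congrArg (of f P) (mul_smul a b (⟨x, hx⟩ : P)).symm
            rw [this]
            exact ih _
      intro x
      have := key2 _ ((of f P).symm x).2 1
      rwa [one_smul] at this
    have hpi : Module.length R (s → N) ≠ ⊤ := by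
      rw [Module.length_pi, ENat.card_eq_coe_fintype_card]
      exact WithTop.mul_ne_top (ENat.natCast_ne_top _) hN
    exact Module.length_ne_top_iff.2
      (IsFiniteLength.of_surjective (Module.length_ne_top_iff.1 hpi) hk)
  have hpos : lengthAlong (ResidueField.map f) ≠ 0 := by
    have : Nontrivial (RestrictAlong (ResidueField.map f) (ResidueField S)) :=
      inferInstanceAs (Nontrivial (ResidueField S))
    exact Module.length_pos.ne'
  have hP : Module.length S P ≠ ⊤ := by
    intro ht
    rw [length_restrictAlong, ht, ENat.top_mul hpos] at hfin
    exact hfin rfl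
  calc Module.length R N ≤ Module.length R (RestrictAlong f P) :=
        Module.length_le_of_injective j hj
    _ = Module.length S P * lengthAlong (ResidueField.map f) := length_restrictAlong f P
    _ ≤ _ := by gcongr; exact length_le_socleLength P hP

/-! ### Powers of a regular sequence -/

section RegularPowers

open RingTheory.Sequence Submodule Function Pointwise

variable {R : Type*} [CommRing R]

theorem socleLength_of_subsingleton (M : Type*) [AddCommGroup M] [Module R M] [Subsingleton M] :
    socleLength R M = 0 := by
  refine le_antisymm (iSup₂_le fun N _ => ?_) bot_le
  rw [Module.length_eq_zero]

theorem isWeaklyRegular_of_subsingleton (M : Type*) [AddCommGroup M] [Module R M] [Subsingleton M]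
    (rs : List R) : IsWeaklyRegular M rs := by
  induction rs generalizing M with
  | nil => exact IsWeaklyRegular.nil R M
  | cons r rs ih => exact IsWeaklyRegular.cons (injective_of_subsingleton _) (ih (QuotSMulTop r M))

variable {A B C : Type*} [AddCommGroup A] [Module R A]
  [AddCommGroup B] [Module R B] [AddCommGroup C] [Module R C]

theorem QuotSMulTop.map_injective_of_isSMulRegular {r : R} (f : A →ₗ[R] B) (g : B →ₗ[R] C)
    (hf : Injective f) (h : Exact f g) (hr : IsSMulRegular C r) :
    Injective (QuotSMulTop.map r f) := by
  have h0 : Exact (0 : PUnit.{1} →ₗ[R] A) f := (LinearMap.exact_zero_iff_injective _ f).2 hf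
  have h1 := QuotSMulTop.map_first_exact_on_four_term_exact_of_isSMulRegular_last h0 h hr
  rw [map_zero] at h1
  exact (LinearMap.exact_zero_iff_injective _ _).1 h1

/-- Weak regularity of a sequence passes from the ends of a short exact sequence to the middle. -/
theorem isWeaklyRegular_of_exact (rs : List R) (f : A →ₗ[R] B) (g : B →ₗ[R] C)
    (hf : Injective f) (h : Exact f g) (hg : Surjective g) (hA : IsWeaklyRegular A rs)
    (hC : IsWeaklyRegular C rs) : IsWeaklyRegular B rs := by
  induction rs generalizing A B C with
  | nil => exact IsWeaklyRegular.nil R B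
  | cons r rs ih =>
    rw [isWeaklyRegular_cons_iff] at hA hC
    exact IsWeaklyRegular.cons
      (isSMulRegular_of_range_eq_ker hf (LinearMap.exact_iff.1 h).symm hA.1 hC.1)
      (ih (QuotSMulTop.map r f) (QuotSMulTop.map r g)
        (QuotSMulTop.map_injective_of_isSMulRegular f g hf h hC.1)
        (QuotSMulTop.map_exact r h hg) (QuotSMulTop.map_surjective r hg) hA.2 hC.2)

/-- Reduction modulo a sequence that is weakly regular on the last term of a short exact sequence
keeps the sequence exact, so `socleLength` is subadditive along it. -/
theorem socleLength_quotient_le_of_exact (rs : List R) (f : A →ₗ[R] B) (g : B →ₗ[R] C)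
    (hf : Injective f) (h : Exact f g) (hg : Surjective g) (hC : IsWeaklyRegular C rs) :
    socleLength R (B ⧸ (Ideal.ofList rs • ⊤ : Submodule R B)) ≤
      socleLength R (A ⧸ (Ideal.ofList rs • ⊤ : Submodule R A)) +
        socleLength R (C ⧸ (Ideal.ofList rs • ⊤ : Submodule R C)) := by
  have h0 : Exact (0 : PUnit.{1} →ₗ[R] A) f := (LinearMap.exact_zero_iff_injective _ f).2 hf
  have h1 := map_first_exact_on_four_term_right_exact_of_isSMulRegular_last h0 h hg hC
  have hz : mapQ _ _ (0 : PUnit.{1} →ₗ[R] A)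
      (smul_top_le_comap_smul_top (Ideal.ofList rs) (0 : PUnit.{1} →ₗ[R] A)) = 0 := by
    ext
    simp
  rw [hz] at h1
  have h3 : Exact g (0 : C →ₗ[R] PUnit.{1}) := (LinearMap.exact_zero_iff_surjective _ g).2 hg
  have h2 := map_first_exact_on_four_term_right_exact_of_isSMulRegular_last h h3
    (fun _ => ⟨0, Subsingleton.elim _ _⟩) (isWeaklyRegular_of_subsingleton (R := R) PUnit.{1} rs)
  exact socleLength_le_add_of_exact _ _ ((LinearMap.exact_zero_iff_injective _ _).1 h1) h2

theorem exact_quotSMulTop_pow (M : Type*) [AddCommGroup M] [Module R M] {x : R}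
    (hx : IsSMulRegular M x) (a : ℕ) :
    ∃ (f : QuotSMulTop (x ^ a) M →ₗ[R] QuotSMulTop (x ^ (a + 1)) M)
      (g : QuotSMulTop (x ^ (a + 1)) M →ₗ[R] QuotSMulTop x M),
      Injective f ∧ Exact f g ∧ Surjective g := by
  have h1 : (x ^ a • ⊤ : Submodule R M) ≤ (x ^ (a + 1) • ⊤ : Submodule R M).comap
      (LinearMap.lsmul R M x) := by
    intro m hm
    obtain ⟨n, -, rfl⟩ := (mem_smul_pointwise_iff_exists _ _ _).1 hm
    refine (mem_smul_pointwise_iff_exists _ _ _).2 ⟨n, mem_top, ?_⟩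
    rw [LinearMap.lsmul_apply, smul_smul, pow_succ']
  have h2 : (x ^ (a + 1) • ⊤ : Submodule R M) ≤ (x • ⊤ : Submodule R M) := by
    intro m hm
    obtain ⟨n, -, rfl⟩ := (mem_smul_pointwise_iff_exists _ _ _).1 hm
    refine (mem_smul_pointwise_iff_exists _ _ _).2 ⟨x ^ a • n, mem_top, ?_⟩
    rw [smul_smul, pow_succ']
  refine ⟨mapQ _ _ _ h1, factor h2, ?_, ?_, factor_surjective h2⟩
  · rw [injective_iff_map_eq_zero]
    intro m
    obtain ⟨m, rfl⟩ := mkQ_surjective _ m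
    intro hm
    rw [mkQ_apply, mapQ_apply, Quotient.mk_eq_zero] at hm
    obtain ⟨n, -, hn⟩ := (mem_smul_pointwise_iff_exists _ _ _).1 hm
    rw [LinearMap.lsmul_apply, pow_succ', mul_smul] at hn
    rw [mkQ_apply, Quotient.mk_eq_zero]
    exact (mem_smul_pointwise_iff_exists _ _ _).2 ⟨n, mem_top, hx hn⟩
  · intro m
    obtain ⟨m, rfl⟩ := mkQ_surjective _ m
    constructor
    · intro hm
      rw [factor_mk, mkQ_apply, Quotient.mk_eq_zero] at hm
      obtain ⟨n, -, rfl⟩ := (mem_smul_pointwise_iff_exists _ _ _).1 hm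
      exact ⟨mkQ _ n, rfl⟩
    · rintro ⟨n, hn⟩
      obtain ⟨n, rfl⟩ := mkQ_surjective _ n
      rw [← hn, mkQ_apply, mapQ_apply, ← mkQ_apply, factor_mk, mkQ_apply, Quotient.mk_eq_zero]
      exact (mem_smul_pointwise_iff_exists _ _ _).2 ⟨n, mem_top, rfl⟩

/-- The module `M / x ^ a M` is filtered by `a` copies of `M / x M`, on each of which `rs` is
weakly regular. -/
theorem isWeaklyRegular_quotSMulTop_pow (M : Type*) [AddCommGroup M] [Module R M] {x : R}
    (hx : IsSMulRegular M x) (rs : List R) (hrs : IsWeaklyRegular (QuotSMulTop x M) rs) (a : ℕ) :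
    IsWeaklyRegular (QuotSMulTop (x ^ a) M) rs ∧
      socleLength R (QuotSMulTop (x ^ a) M ⧸
          (Ideal.ofList rs • ⊤ : Submodule R (QuotSMulTop (x ^ a) M))) ≤
        a * socleLength R (QuotSMulTop x M ⧸
          (Ideal.ofList rs • ⊤ : Submodule R (QuotSMulTop x M))) := by
  induction a with
  | zero =>
    have : Subsingleton (QuotSMulTop (x ^ 0) M) := by
      rw [pow_zero, QuotSMulTop, one_smul]
      infer_instance
    refine ⟨isWeaklyRegular_of_subsingleton _ _, ?_⟩
    rw [socleLength_of_subsingleton]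
    exact bot_le
  | succ a ih =>
    obtain ⟨f, g, hf, h, hg⟩ := exact_quotSMulTop_pow M hx a
    refine ⟨isWeaklyRegular_of_exact rs f g hf h hg ih.1 hrs,
      (socleLength_quotient_le_of_exact rs f g hf h hg hrs).trans ?_⟩
    rw [Nat.cast_add, Nat.cast_one, add_mul, one_mul]
    gcongr
    exact ih.2

theorem socleLength_quotient_map_pow_le (M : Type*) [AddCommGroup M] [Module R M] (rs : List R)
    (hrs : IsWeaklyRegular M rs) (a : ℕ) :
    socleLength R (M ⧸ (Ideal.ofList (rs.map (· ^ a)) • ⊤ : Submodule R M)) ≤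
      a ^ rs.length * socleLength R (M ⧸ (Ideal.ofList rs • ⊤ : Submodule R M)) := by
  induction rs generalizing M with
  | nil => rw [List.map_nil, List.length_nil, pow_zero, one_mul]
  | cons x rs ih =>
    rw [isWeaklyRegular_cons_iff] at hrs
    obtain ⟨h1, h2⟩ := isWeaklyRegular_quotSMulTop_pow M hrs.1 rs hrs.2 a
    rw [List.map_cons, (quotOfListConsSMulTopEquivQuotSMulTopInner M _ _).socleLength_eq,
      (quotOfListConsSMulTopEquivQuotSMulTopInner M x rs).socleLength_eq, List.length_cons,
      pow_succ, mul_assoc]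
    exact (ih _ h1).trans (by gcongr)

end RegularPowers

/-! ### F-finite rings and the degree of the Frobenius map -/

theorem charP_of_ringHom {R A : Type*} [CommRing R] [CommRing A] [Nontrivial A] (p : ℕ)
    [hp : Fact p.Prime] [CharP R p] (f : R →+* A) : CharP A p :=
  (CharP.charP_iff_prime_eq_zero hp.out).2 (by
    rw [← map_natCast f, CharP.cast_eq_zero, map_zero])

theorem isFFinite_iff {R : Type*} [CommRing R] {p : ℕ} [Fact p.Prime] [CharP R p] :
    IsFFinite R p ↔ Module.Finite R (RestrictAlong (frobenius R p) R) := Iff.rfl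

theorem isFFinite_iff_exists {R : Type*} [CommRing R] {p : ℕ} [Fact p.Prime] [CharP R p] :
    IsFFinite R p ↔ ∃ (n : ℕ) (g : Fin n → R), ∀ x, ∃ c : Fin n → R, x = ∑ j, c j ^ p * g j := by
  rw [isFFinite_iff, Module.finite_def, Submodule.fg_iff_exists_fin_generating_family]
  refine exists_congr fun n => exists_congr fun g => ?_
  rw [Submodule.eq_top_iff']
  refine forall_congr' fun x => ?_
  rw [Submodule.mem_span_range_iff_exists_fun]
  exact exists_congr fun c => eq_comm

/-- F-finiteness passes to quotients and to localizations. -/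
theorem IsFFinite.of_ringHom {R A : Type*} [CommRing R] [CommRing A] {p : ℕ}
    [Fact p.Prime] [CharP R p] [CharP A p] (f : R →+* A)
    (h : ∀ a, ∃ r s, IsUnit (f s) ∧ a * f s ^ p = f r) (hR : IsFFinite R p) : IsFFinite A p := by
  rw [isFFinite_iff_exists] at hR ⊢
  obtain ⟨n, g, hg⟩ := hR
  refine ⟨n, fun j => f (g j), fun a => ?_⟩
  obtain ⟨r, s, ⟨u, hu⟩, hr⟩ := h a
  obtain ⟨c, hc⟩ := hg r
  refine ⟨fun j => f (c j) * ↑u⁻¹, ?_⟩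
  have h1 : a = (∑ j, f (c j) ^ p * f (g j)) * (↑u⁻¹ : A) ^ p := by
    rw [hc, map_sum] at hr
    simp only [map_mul, map_pow] at hr
    rw [← hr, ← hu, mul_assoc, ← mul_pow, Units.mul_inv, one_pow, mul_one]
  rw [h1, Finset.sum_mul]
  exact Finset.sum_congr rfl fun j _ => by ring

theorem IsFFinite.of_surjective {R A : Type*} [CommRing R] [CommRing A] {p : ℕ}
    [Fact p.Prime] [CharP R p] [CharP A p] (f : R →+* A) (hf : Function.Surjective f)
    (hR : IsFFinite R p) : IsFFinite A p :=
  hR.of_ringHom f fun a => by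
    obtain ⟨r, rfl⟩ := hf a
    exact ⟨r, 1, by simp, by simp⟩

theorem IsFFinite.of_isLocalization {R A : Type*} [CommRing R] [CommRing A] {p : ℕ}
    [hp : Fact p.Prime] [CharP R p] [CharP A p] [Algebra R A] (S : Submonoid R)
    [IsLocalization S A] (hR : IsFFinite R p) : IsFFinite A p :=
  hR.of_ringHom (algebraMap R A) fun a => by
    obtain ⟨r, s, rfl⟩ := IsLocalization.exists_mk'_eq S a
    refine ⟨r * s ^ (p - 1), s, IsLocalization.map_units A s, ?_⟩
    obtain ⟨k, hk⟩ := Nat.exists_eq_succ_of_ne_zero hp.out.ne_zero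
    rw [hk, Nat.succ_sub_one, pow_succ', ← mul_assoc, IsLocalization.mk'_spec, map_mul, map_pow]

/-- The degree `[K : K ^ p]` of a field of characteristic `p` over its subfield of
`p`-th powers. -/
noncomputable def frobeniusDegree (K : Type*) [Field K] (p : ℕ) [Fact p.Prime] [CharP K p] : ℕ∞ :=
  lengthAlong (frobenius K p)

section FrobeniusDegree

variable {p : ℕ} [Fact p.Prime]

theorem frobeniusDegree_eq_of_ringEquiv {K L : Type*} [Field K] [Field L] [CharP K p] [CharP L p]
    (e : K ≃+* L) : frobeniusDegree K p = frobeniusDegree L p :=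
  lengthAlong_eq_of_ringEquiv _ _ e fun x => by simp [frobenius_def]

theorem frobeniusDegree_ne_zero (K : Type*) [Field K] [CharP K p] :
    frobeniusDegree K p ≠ 0 := by
  have : Nontrivial (RestrictAlong (frobenius K p) K) := inferInstanceAs (Nontrivial K)
  exact Module.length_pos.ne'

theorem IsFFinite.frobeniusDegree_eq {K : Type*} [Field K] [CharP K p] (h : IsFFinite K p) :
    frobeniusDegree K p = Module.finrank K (RestrictAlong (frobenius K p) K) :=
  have : Module.Finite K (RestrictAlong (frobenius K p) K) := h
  Module.length_eq_finrank _ _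

theorem lengthAlong_iterateFrobenius (K : Type*) [Field K] [CharP K p] (e : ℕ) :
    lengthAlong (iterateFrobenius K p e) = frobeniusDegree K p ^ e := by
  induction e with
  | zero =>
    rw [iterateFrobenius_zero, pow_zero]
    exact Module.length_eq_one K K
  | succ e ih =>
    have : iterateFrobenius K p (e + 1) =
        (iterateFrobenius K p e).comp (frobenius K p) := by
      ext x
      simp [iterateFrobenius_def, frobenius_def, pow_succ', pow_mul]
    rw [this, lengthAlong_comp, ih, pow_succ, frobeniusDegree]

theorem isLocalHom_iterateFrobenius (R : Type*) [CommRing R] [CharP R p] (e : ℕ) :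
    IsLocalHom (iterateFrobenius R p e) where
  map_nonunit a ha := by
    rw [iterateFrobenius_def] at ha
    exact (isUnit_pow_iff (pow_ne_zero e (Fact.out : p.Prime).ne_zero)).1 ha

theorem lengthAlong_residueFieldMap_iterateFrobenius (R : Type*) [CommRing R] [IsLocalRing R]
    [CharP R p] [CharP (ResidueField R) p] (e : ℕ) [IsLocalHom (iterateFrobenius R p e)] :
    lengthAlong (ResidueField.map (iterateFrobenius R p e)) =
      frobeniusDegree (ResidueField R) p ^ e := by
  rw [← lengthAlong_iterateFrobenius]
  congr 1

theorem IsFFinite.iterateFrobenius_finite {R : Type*} [CommRing R] [CharP R p]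
    (h : IsFFinite R p) (e : ℕ) : (iterateFrobenius R p e).Finite := by
  induction e with
  | zero =>
    rw [iterateFrobenius_zero]
    exact RingHom.Finite.id R
  | succ e ih =>
    have : iterateFrobenius R p (e + 1) =
        (iterateFrobenius R p e).comp (frobenius R p) := by
      ext x
      simp [iterateFrobenius_def, frobenius_def, pow_succ', pow_mul]
    rw [this]
    exact ih.comp h

end FrobeniusDegree

/-! ### Coordinates on an F-finite domain -/

open RestrictAlong in
/-- The restriction of scalars of an F-finite domain `A` along Frobenius embeds into a free module
of rank `[K : K ^ p]`, where `K` is the fraction field, with torsion cokernel. -/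
theorem IsFFinite.exists_injective_linearMap {A : Type*} (K : Type*) [CommRing A] [IsDomain A]
    [Field K] [Algebra A K] [IsFractionRing A K] {p : ℕ} [Fact p.Prime] [CharP A p] [CharP K p]
    (hA : IsFFinite A p) :
    ∃ (n : ℕ) (ψ : RestrictAlong (frobenius A p) A →ₗ[A] (Fin n → A)) (c : A),
      frobeniusDegree K p = n ∧ Function.Injective ψ ∧ c ≠ 0 ∧
        ∀ i, Pi.single i c ∈ LinearMap.range ψ := by
  have hK : IsFFinite K p := hA.of_isLocalization (nonZeroDivisors A)
  have : Module.Finite K (RestrictAlong (frobenius K p) K) := hK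
  refine ⟨Module.finrank K (RestrictAlong (frobenius K p) K), ?_⟩
  let n := Module.finrank K (RestrictAlong (frobenius K p) K)
  let β := Module.finBasis K (RestrictAlong (frobenius K p) K)
  have hmul : ∀ a x : A, β.equivFun (of (frobenius K p) K (algebraMap A K (a ^ p * x))) =
      a • β.equivFun (of (frobenius K p) K (algebraMap A K x)) := by
    intro a x
    have : of (frobenius K p) K (algebraMap A K (a ^ p * x)) =
        algebraMap A K a • of (frobenius K p) K (algebraMap A K x) := by
      rw [smul_of, map_mul, map_pow, frobenius_def, smul_eq_mul]
    rw [this, map_smul, algebraMap_smul]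
  let ψ₀ : RestrictAlong (frobenius A p) A →ₗ[A] (Fin n → K) :=
    { toFun := fun x => β.equivFun (of (frobenius K p) K (algebraMap A K x))
      map_add' := fun x y => by
        rw [← map_add, ← map_add]
        exact congrArg (fun z => β.equivFun (of (frobenius K p) K z)) (map_add (algebraMap A K) x y)
      map_smul' := fun a x => hmul a x }
  have hψ₀ : Function.Injective ψ₀ :=
    β.equivFun.injective.comp (IsFractionRing.injective A K)
  let ι : (Fin n → A) →ₗ[A] (Fin n → K) := LinearMap.compLeft (Algebra.linearMap A K) (Fin n)
  have hι : Function.Injective ι := (IsFractionRing.injective A K).comp_left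
  -- a common denominator `t` of the coordinates of a finite set of generators
  obtain ⟨t, ht0, ht⟩ : ∃ t : A, t ≠ 0 ∧ ∀ x, t • ψ₀ x ∈ LinearMap.range ι := by
    obtain ⟨m, g, hg⟩ := Submodule.fg_iff_exists_fin_generating_family.1
      (Module.finite_def.1 (isFFinite_iff.1 hA))
    obtain ⟨t, ht⟩ := IsLocalization.exist_integer_multiples_of_finite (nonZeroDivisors A)
      (fun ij : Fin m × Fin n => ψ₀ (g ij.1) ij.2)
    refine ⟨t, nonZeroDivisors.ne_zero t.2, fun x => ?_⟩
    have hx : x ∈ Submodule.span A (Set.range g) := hg ▸ Submodule.mem_top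
    induction hx using Submodule.span_induction with
    | mem x hx =>
      obtain ⟨j, rfl⟩ := hx
      choose u hu using fun i => ht (j, i)
      exact ⟨u, funext hu⟩
    | zero => rw [map_zero, smul_zero]; exact Submodule.zero_mem _
    | add x y _ _ hx hy => rw [map_add, smul_add]; exact Submodule.add_mem _ hx hy
    | smul a x _ hx => rw [map_smul, smul_comm]; exact Submodule.smul_mem _ _ hx
  let ψ : RestrictAlong (frobenius A p) A →ₗ[A] (Fin n → A) :=
    (LinearEquiv.ofInjective ι hι).symm.toLinearMap ∘ₗ (t • ψ₀).codRestrict _ ht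
  have hψ : ∀ x, ι (ψ x) = t • ψ₀ x := fun x => by
    have := LinearEquiv.ofInjective_symm_apply (f := ι) (h := hι) ((t • ψ₀).codRestrict _ ht x)
    exact this
  -- a common denominator `s` of the basis
  obtain ⟨s, hs⟩ := IsLocalization.exist_integer_multiples_of_finite (nonZeroDivisors A)
    (fun i => (of (frobenius K p) K).symm (β i))
  choose b hb using hs
  have hbs : ∀ i, ∃ y, ψ₀ y = Pi.single i (algebraMap A K s) := by
    intro i
    refine ⟨of (frobenius A p) A ((s : A) ^ (p - 1) * b i), ?_⟩
    have h1 : of (frobenius K p) K (algebraMap A K ((s : A) ^ (p - 1) * b i)) =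
        algebraMap A K s • β i := by
      have h2 : algebraMap A K ((s : A) ^ (p - 1) * b i) =
          (algebraMap A K s) ^ p * (of (frobenius K p) K).symm (β i) := by
        rw [map_mul, hb i, Algebra.smul_def, ← mul_assoc, map_pow,
          pow_sub_one_mul (Fact.out : p.Prime).ne_zero]
      rw [h2]
      rfl
    have h3 : ψ₀ (of (frobenius A p) A ((s : A) ^ (p - 1) * b i)) =
        β.equivFun (algebraMap A K s • β i) := congrArg β.equivFun h1
    rw [h3, map_smul]
    ext j
    rw [Pi.smul_apply, Module.Basis.equivFun_self, Pi.single_apply]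
    simp [eq_comm]
  refine ⟨ψ, t * s, hK.frobeniusDegree_eq, fun x y hxy => hψ₀ ?_, mul_ne_zero ht0
    (nonZeroDivisors.ne_zero s.2), fun i => ?_⟩
  · have h1 : t • ψ₀ x = t • ψ₀ y := by rw [← hψ, ← hψ, hxy]
    rw [← algebraMap_smul K t, ← algebraMap_smul K t] at h1
    exact smul_right_injective _
      ((map_ne_zero_iff _ (IsFractionRing.injective A K)).2 ht0) h1
  · obtain ⟨y, hy⟩ := hbs i
    refine ⟨y, hι ?_⟩
    rw [hψ, hy]
    ext j
    by_cases hij : j = i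
    · subst hij; simp [ι, Algebra.smul_def]
    · simp [ι, Pi.single_eq_of_ne hij]

/-! ### Comparison of the Frobenius degrees of the fraction field and of the residue field -/

section DimensionOne

open Submodule Function Pointwise

/-- A submodule of finite colength has the same length modulo a regular element as the ambient
module. -/
theorem length_quotSMulTop_eq_of_injective {R M N : Type*} [CommRing R] [AddCommGroup M]
    [Module R M] [AddCommGroup N] [Module R N] (ψ : M →ₗ[R] N) (hψ : Injective ψ)
    (hT : Module.length R (N ⧸ LinearMap.range ψ) ≠ ⊤) {x : R} (hx : IsSMulRegular N x) :
    Module.length R (QuotSMulTop x M) = Module.length R (QuotSMulTop x N) := by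
  -- The length of `N / x ψ(M)` is computed through `ψ(M)` and through `x N`.
  let P : Submodule R N := x • LinearMap.range ψ
  have h1 : (x • ⊤ : Submodule R M) ≤ P.comap ψ := by
    intro m hm
    obtain ⟨n, -, rfl⟩ := (mem_smul_pointwise_iff_exists _ _ _).1 hm
    exact (mem_smul_pointwise_iff_exists _ _ _).2 ⟨ψ n, ⟨n, rfl⟩, (map_smul ψ x n).symm⟩
  have h2 : P ≤ LinearMap.range ψ := by
    intro m hm
    obtain ⟨n, hn, rfl⟩ := (mem_smul_pointwise_iff_exists _ _ _).1 hm
    exact smul_mem _ _ hn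
  have h3 : LinearMap.range ψ ≤ P.comap (LinearMap.lsmul R N x) := fun m hm =>
    (mem_smul_pointwise_iff_exists _ _ _).2 ⟨m, hm, rfl⟩
  have h4 : P ≤ (x • ⊤ : Submodule R N) := by
    intro m hm
    obtain ⟨n, hn, rfl⟩ := (mem_smul_pointwise_iff_exists _ _ _).1 hm
    exact (mem_smul_pointwise_iff_exists _ _ _).2 ⟨n, mem_top, rfl⟩
  have e1 : Module.length R (N ⧸ P) =
      Module.length R (QuotSMulTop x M) + Module.length R (N ⧸ LinearMap.range ψ) := by
    refine Module.length_eq_add_of_exact (mapQ _ _ ψ h1) (factor h2) ?_ (factor_surjective h2) ?_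
    · rw [injective_iff_map_eq_zero]
      intro m
      obtain ⟨m, rfl⟩ := mkQ_surjective _ m
      intro hm
      rw [mkQ_apply, mapQ_apply, Quotient.mk_eq_zero] at hm
      obtain ⟨-, ⟨n, rfl⟩, hn⟩ := (mem_smul_pointwise_iff_exists _ _ _).1 hm
      rw [← map_smul] at hn
      rw [mkQ_apply, Quotient.mk_eq_zero]
      exact (mem_smul_pointwise_iff_exists _ _ _).2 ⟨n, mem_top, hψ hn⟩
    · intro m
      obtain ⟨m, rfl⟩ := mkQ_surjective _ m
      rw [factor_mk, mkQ_apply, Quotient.mk_eq_zero]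
      constructor
      · rintro ⟨n, rfl⟩
        exact ⟨mkQ _ n, rfl⟩
      · rintro ⟨n, hn⟩
        obtain ⟨n, rfl⟩ := mkQ_surjective _ n
        rw [mkQ_apply, mkQ_apply, mapQ_apply, Submodule.Quotient.eq] at hn
        have := (LinearMap.range ψ).sub_mem (⟨n, rfl⟩ : ψ n ∈ LinearMap.range ψ) (h2 hn)
        rwa [sub_sub_cancel] at this
  have e2 : Module.length R (N ⧸ P) =
      Module.length R (N ⧸ LinearMap.range ψ) + Module.length R (QuotSMulTop x N) := by
    refine Module.length_eq_add_of_exact (mapQ _ _ (LinearMap.lsmul R N x) h3) (factor h4) ?_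
      (factor_surjective h4) ?_
    · rw [injective_iff_map_eq_zero]
      intro m
      obtain ⟨m, rfl⟩ := mkQ_surjective _ m
      intro hm
      rw [mkQ_apply, mapQ_apply, Quotient.mk_eq_zero] at hm
      obtain ⟨n, hn, hnm⟩ := (mem_smul_pointwise_iff_exists _ _ _).1 hm
      rw [mkQ_apply, Quotient.mk_eq_zero]
      exact hx hnm ▸ hn
    · intro m
      obtain ⟨m, rfl⟩ := mkQ_surjective _ m
      rw [factor_mk, mkQ_apply, Quotient.mk_eq_zero]
      constructor
      · intro hm
        obtain ⟨n, -, rfl⟩ := (mem_smul_pointwise_iff_exists _ _ _).1 hm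
        exact ⟨mkQ _ n, rfl⟩
      · rintro ⟨n, hn⟩
        obtain ⟨n, rfl⟩ := mkQ_surjective _ n
        rw [mkQ_apply, mkQ_apply, mapQ_apply, Submodule.Quotient.eq] at hn
        have h5 : (LinearMap.lsmul R N x) n ∈ (x • ⊤ : Submodule R N) :=
          (mem_smul_pointwise_iff_exists _ _ _).2 ⟨n, mem_top, rfl⟩
        have := (x • ⊤ : Submodule R N).sub_mem h5 (h4 hn)
        rwa [sub_sub_cancel] at this
  rw [e2, add_comm] at e1
  exact (WithTop.add_right_cancel hT e1).symm

theorem length_quotSMulTop_pi {A : Type*} [CommRing A] (n : ℕ) (x : A) :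
    Module.length A (QuotSMulTop x (Fin n → A)) = n * Ring.ord A x := by
  rw [((QuotSMulTop.equivQuotTensor x (Fin n → A)).trans
    (TensorProduct.piScalarRight A A (A ⧸ Ideal.span {x}) (Fin n))).length_eq,
    Module.length_pi, ENat.card_eq_coe_fintype_card, Fintype.card_fin, Ring.ord]

open RestrictAlong in
theorem length_quotSMulTop_restrictAlong {R S : Type*} [CommRing R] [CommRing S] (f : R →+* S)
    (x : R) : Module.length R (QuotSMulTop x (RestrictAlong f S)) =
      Module.length R (RestrictAlong f (S ⧸ Ideal.span {f x})) := by
  let g : RestrictAlong f S →ₗ[R] RestrictAlong f (S ⧸ Ideal.span {f x}) :=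
    RestrictAlong.map f (mkQ (Ideal.span {f x}))
  have hg : Surjective g := mkQ_surjective (Ideal.span {f x})
  have hker : LinearMap.ker g = x • ⊤ := by
    ext m
    have h1 : m ∈ LinearMap.ker g ↔ (of f S).symm m ∈ Ideal.span {f x} :=
      Submodule.Quotient.mk_eq_zero (Ideal.span {f x})
    rw [h1, Ideal.mem_span_singleton', mem_smul_pointwise_iff_exists]
    constructor
    · rintro ⟨a, ha⟩
      exact ⟨of f S a, mem_top, by rw [smul_of, smul_eq_mul, mul_comm, ha]; rfl⟩
    · rintro ⟨a, -, rfl⟩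
      exact ⟨(of f S).symm a, mul_comm _ _⟩
  exact ((quotEquivOfEq _ _ hker).symm.trans
    (LinearMap.quotKerEquivOfSurjective g hg)).length_eq

/-- For an F-finite local domain of dimension one the degree of Frobenius on the fraction field is
at least `p` times the degree on the residue field. Both sides are obtained from the length
of `A`, restricted along Frobenius, modulo a nonzero element of the maximal ideal. -/
theorem IsFFinite.mul_frobeniusDegree_residueField_le {A : Type*} (K : Type*) [CommRing A]
    [IsDomain A] [IsLocalRing A] [IsNoetherianRing A] [Ring.KrullDimLE 1 A] (hf : ¬ IsField A)
    [Field K] [Algebra A K] [IsFractionRing A K] {p : ℕ} [hp : Fact p.Prime] [CharP A p]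
    [CharP K p] [CharP (ResidueField A) p] (hA : IsFFinite A p) :
    p * frobeniusDegree (ResidueField A) p ≤ frobeniusDegree K p := by
  obtain ⟨n, ψ, c, hn, hψ, hc, hψc⟩ := hA.exists_injective_linearMap K
  obtain ⟨x, hxm, hx0⟩ := Submodule.exists_mem_ne_zero_of_ne_bot
    (fun h => hf (isField_iff_maximalIdeal_eq.2 h))
  have hT : Module.length A ((Fin n → A) ⧸ LinearMap.range ψ) ≠ ⊤ := by
    have hle : (c • ⊤ : Submodule A (Fin n → A)) ≤ LinearMap.range ψ := by
      intro m hm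
      obtain ⟨v, -, rfl⟩ := (mem_smul_pointwise_iff_exists _ _ _).1 hm
      rw [← Finset.univ_sum_single (c • v)]
      refine sum_mem fun i _ => ?_
      have : Pi.single i ((c • v) i) = v i • (Pi.single i c : Fin n → A) := by
        rw [← Pi.single_smul, Pi.smul_apply, smul_eq_mul, smul_eq_mul, mul_comm]
      rw [this]
      exact smul_mem _ _ (hψc i)
    refine ne_top_of_le_ne_top ?_ (Module.length_le_of_surjective (factor hle)
      (factor_surjective hle))
    change Module.length A (QuotSMulTop c (Fin n → A)) ≠ ⊤
    rw [length_quotSMulTop_pi]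
    exact WithTop.mul_ne_top (ENat.natCast_ne_top _)
      (Ring.ord_ne_top (mem_nonZeroDivisors_of_ne_zero hc))
  have hreg : IsSMulRegular (Fin n → A) x := fun v w hvw => funext fun i =>
    mul_left_cancel₀ hx0 (congrFun hvw i)
  have : IsLocalHom (frobenius A p) := ⟨fun a ha => (isUnit_pow_iff hp.out.ne_zero).1 ha⟩
  have hres : lengthAlong (ResidueField.map (frobenius A p)) =
      frobeniusDegree (ResidueField A) p := by
    rw [frobeniusDegree]
    congr 1
  have key := length_quotSMulTop_eq_of_injective ψ hψ hT hreg
  rw [length_quotSMulTop_restrictAlong, length_restrictAlong, hres, length_quotSMulTop_pi,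
    ← Ring.ord, frobenius_def, Ring.ord_pow (mem_nonZeroDivisors_of_ne_zero hx0)] at key
  have hord : Ring.ord A x ≠ ⊤ := Ring.ord_ne_top (mem_nonZeroDivisors_of_ne_zero hx0)
  have hord0 : Ring.ord A x ≠ 0 := by
    have : Nontrivial (A ⧸ Ideal.span {x}) := Ideal.Quotient.nontrivial_iff.2 fun h =>
      hxm (Ideal.span_singleton_eq_top.1 h)
    exact Module.length_pos.ne'
  rw [hn, ← ENat.mul_le_mul_right_iff hord0 hord, ← key, nsmul_eq_mul]
  exact le_of_eq (by ring)

end DimensionOne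

/-- The residue field of a local ring is its only field quotient. -/
theorem nonempty_residueField_ringEquiv {R k : Type*} [CommRing R] [IsLocalRing R] [Field k]
    (f : R →+* k) (hf : Function.Surjective f) : Nonempty (ResidueField R ≃+* k) :=
  ⟨(Ideal.quotEquivOfEq (eq_maximalIdeal (RingHom.ker_isMaximal_of_surjective f hf)).symm).trans
    (RingHom.quotientKerEquivOfSurjective hf)⟩

theorem frobeniusDegree_fractionRing_eq (A K : Type*) [CommRing A] [IsDomain A] [Field K]
    [Algebra A K] [IsFractionRing A K] {p : ℕ} [Fact p.Prime] [CharP (FractionRing A) p]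
    [CharP K p] : frobeniusDegree (FractionRing A) p = frobeniusDegree K p :=
  frobeniusDegree_eq_of_ringEquiv (FractionRing.algEquiv A K).toRingEquiv

/-- For an F-finite Noetherian local domain of dimension `n`, the degree of Frobenius on the
fraction field is at least `p ^ n` times the degree on the residue field. The dimension is
reduced by passing to `R_Q` and `R / Q` for a prime `Q` of height `n - 1`. -/
theorem pow_mul_frobeniusDegree_residueField_le {p : ℕ} [Fact p.Prime] (n : ℕ) :
    ∀ (R : Type*) [CommRing R] [IsDomain R] [IsLocalRing R] [IsNoetherianRing R] [CharP R p]
      [CharP (ResidueField R) p] [CharP (FractionRing R) p], IsFFinite R p →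
      ringKrullDim R = n →
        (p : ℕ∞) ^ n * frobeniusDegree (ResidueField R) p ≤
          frobeniusDegree (FractionRing R) p := by
  induction n with
  | zero =>
    intro R _ _ _ _ _ _ _ hR hdim
    have : Ring.KrullDimLE 0 R := Ring.krullDimLE_iff.2 hdim.le
    let e₀ := IsLocalization.atUnits R (nonZeroDivisors R) (S := FractionRing R) fun x hx => by
      obtain ⟨y, hy⟩ := (Ring.KrullDimLE.isField_of_isDomain (R := R)).mul_inv_cancel
        (nonZeroDivisors.ne_zero hx)
      exact IsUnit.of_mul_eq_one y hy
    obtain ⟨e⟩ := nonempty_residueField_ringEquiv (e₀ : R →+* FractionRing R) e₀.surjective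
    rw [pow_zero, one_mul, frobeniusDegree_eq_of_ringEquiv e]
  | succ n ih =>
    intro R _ _ _ _ _ _ _ hR hdim
    have hht : Order.height (closedPoint R) = (n : ℕ∞) + 1 := by
      have h1 := maximalIdeal_height_eq_ringKrullDim (R := R)
      rw [hdim] at h1
      have h2 := (closedPoint R).height_eq_orderHeight
      rw [← h2]
      exact_mod_cast h1
    obtain ⟨-, ⟨Q, hQ, hQn⟩, hle⟩ := Order.height_eq_coe_add_one_iff.1 hht
    let A := Localization.AtPrime Q.asIdeal
    have hAdim : ringKrullDim A = n := by
      rw [IsLocalization.AtPrime.ringKrullDim_eq_height Q.asIdeal A, Q.height_eq_orderHeight, hQn]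
      rfl
    have hAdom : IsDomain A := IsLocalization.isDomain_localization
      (le_nonZeroDivisors_of_noZeroDivisors (fun h => h Q.asIdeal.zero_mem))
    have hAK : IsFractionRing A (FractionRing R) := inferInstance
    have : CharP A p := charP_of_ringHom p (algebraMap R A)
    have : CharP (ResidueField A) p := charP_of_ringHom p (residue A)
    have : CharP (FractionRing A) p := charP_of_ringHom p (algebraMap A (FractionRing A))
    have h1 := ih A (hR.of_isLocalization Q.asIdeal.primeCompl) hAdim
    rw [frobeniusDegree_fractionRing_eq A (FractionRing R)] at h1
    let B := R ⧸ Q.asIdeal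
    have : CharP B p := charP_of_ringHom p (Ideal.Quotient.mk Q.asIdeal)
    have hBloc : IsLocalRing B := IsLocalRing.of_surjective' (Ideal.Quotient.mk Q.asIdeal)
      Ideal.Quotient.mk_surjective
    have : CharP (ResidueField B) p := charP_of_ringHom p (residue B)
    have hBfield : ¬ IsField B := fun h => by
      have h2 := eq_maximalIdeal (Ideal.Quotient.maximal_of_isField _ h)
      exact hQ.ne (PrimeSpectrum.ext h2)
    have hBdim : Ring.KrullDimLE 1 B := by
      rw [Ring.krullDimLE_one_iff_of_noZeroDivisors]
      intro I hI hIp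
      -- A prime strictly between `Q` and the maximal ideal would have height exceeding `n`.
      let P : PrimeSpectrum R := PrimeSpectrum.comap (Ideal.Quotient.mk Q.asIdeal) ⟨I, hIp⟩
      have hQP : Q < P := by
        refine lt_of_le_of_ne (fun x hx => ?_) fun heq => hI ?_
        · change Ideal.Quotient.mk Q.asIdeal x ∈ I
          rw [Ideal.Quotient.eq_zero_iff_mem.2 hx]
          exact I.zero_mem
        · rw [eq_bot_iff]
          intro y hy
          obtain ⟨x, rfl⟩ := Ideal.Quotient.mk_surjective y
          have hx : x ∈ Q.asIdeal := by
            rw [heq]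
            exact hy
          exact Ideal.Quotient.eq_zero_iff_mem.2 hx
      have hPm : P = closedPoint R := by
        by_contra hne
        have hPlt : P < closedPoint R := lt_of_le_of_ne (le_maximalIdeal P.2.ne_top) hne
        have h3 := (Order.height_add_one_le hQP).trans (hle P hPlt)
        rw [hQn] at h3
        exact absurd h3 (not_le.2 (by exact_mod_cast Nat.lt_succ_self n))
      have hImax : I = maximalIdeal B := by
        refine le_antisymm (le_maximalIdeal hIp.ne_top) fun y hy => ?_
        obtain ⟨x, rfl⟩ := Ideal.Quotient.mk_surjective y
        have hx : x ∈ (closedPoint R).asIdeal := fun hu => hy (hu.map _)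
        rw [← hPm] at hx
        exact hx
      rw [hImax]
      exact maximalIdeal.isMaximal B
    have h2 : (p : ℕ∞) * frobeniusDegree (ResidueField B) p ≤
        frobeniusDegree (ResidueField A) p :=
      (hR.of_surjective (Ideal.Quotient.mk Q.asIdeal)
        Ideal.Quotient.mk_surjective).mul_frobeniusDegree_residueField_le
        Q.asIdeal.ResidueField hBfield
    obtain ⟨e⟩ := nonempty_residueField_ringEquiv
      ((residue B).comp (Ideal.Quotient.mk Q.asIdeal))
      (residue_surjective.comp Ideal.Quotient.mk_surjective)
    rw [frobeniusDegree_eq_of_ringEquiv e, pow_succ, mul_assoc]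
    exact le_trans (by gcongr) h1

/-! ### Cartier maps -/

/-- A `q⁻¹`-linear map from a ring `R` to an `R`-module, `q` being a power of the characteristic:
an additive map `φ` with `φ (r ^ q * x) = r • φ x`, that is, an `R`-linear map `F^e_* R → M`
when `q = p ^ e`. -/
def IsCartierMap {R M : Type*} [CommRing R] [AddCommGroup M] [Module R M] (q : ℕ)
    (φ : R →+ M) : Prop :=
  ∀ r x, φ (r ^ q * x) = r • φ x

/-- Every element outside all minimal primes is sent to `1` by some Cartier map. -/
def HasCartierSplittings (R : Type*) [CommRing R] (p : ℕ) : Prop :=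
  ∀ f : R, (∀ Q ∈ minimalPrimes R, f ∉ Q) →
    ∃ e : ℕ, 1 ≤ e ∧ ∃ φ : R →+ R, IsCartierMap (p ^ e) φ ∧ φ f = 1

theorem IsStronglyFRegular.hasCartierSplittings {R : Type*} [CommRing R] {p : ℕ} [Fact p.Prime]
    [CharP R p] (h : IsStronglyFRegular R p) : HasCartierSplittings R p := by
  intro f hf
  obtain ⟨e, he, φ, hφ⟩ := h.2 f hf
  refine ⟨e, he, φ.toAddMonoidHom.comp (FrobeniusPushforward.of R p e).toAddMonoidHom,
    fun r x => ?_, hφ⟩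
  exact (congrArg φ (FrobeniusPushforward.smul_of R p e r x).symm).trans (φ.map_smul r _)

theorem HasCartierSplittings.isReduced {R : Type*} [CommRing R] {p : ℕ} [hp : Fact p.Prime]
    (h : HasCartierSplittings R p) : IsReduced R := by
  rw [isReduced_iff_pow_one_lt 2 one_lt_two]
  intro x hx
  obtain ⟨e, he, φ, hφ, h1⟩ := h 1 fun Q hQ =>
    (Ideal.ne_top_iff_one Q).1 hQ.1.1.ne_top
  have h2 := hφ x 1
  have h3 : 2 ≤ p ^ e := hp.out.two_le.trans (Nat.le_self_pow (by lia) p)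
  rw [pow_eq_zero_of_le h3 hx, zero_mul, map_zero, h1, smul_eq_mul, mul_one] at h2
  exact h2.symm

/-- A set of minimal primes of a Noetherian ring is cut out, among all minimal primes, by the
membership of a single element. -/
theorem exists_mem_minimalPrimes_iff {R : Type*} [CommRing R] [IsNoetherianRing R]
    (S : Set (Ideal R)) : ∃ c : R, ∀ Q ∈ minimalPrimes R, c ∈ Q ↔ Q ∈ S := by
  have hfin := minimalPrimes.finite_of_isNoetherianRing R
  let I : Ideal R := sInf (minimalPrimes R ∩ S)
  have hnot : ¬ ((I : Set R) ⊆ ⋃ Q ∈ minimalPrimes R \ S, (Q : Set R)) := by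
    intro hsub
    obtain ⟨Q, ⟨hQ, hQS⟩, hIQ⟩ := (Ideal.subset_union_prime_finite (f := id) (hfin.subset
      Set.sdiff_subset) ⊥ ⊥ fun Q hQ _ _ => hQ.1.1.1).1 hsub
    have hfin' : (minimalPrimes R ∩ S).Finite := hfin.subset Set.inter_subset_left
    have hI : hfin'.toFinset.inf id ≤ Q := by
      refine le_trans (le_sInf fun P hP => ?_) hIQ
      exact Finset.inf_le (f := id) (hfin'.mem_toFinset.2 hP)
    obtain ⟨P, hP, hPQ⟩ := (Ideal.IsPrime.inf_le' hQ.1.1).1 hI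
    have hP' := hfin'.mem_toFinset.1 hP
    have : P = Q := le_antisymm hPQ (hQ.2 hP'.1.1 hPQ)
    exact hQS (this ▸ hP'.2)
  obtain ⟨c, hc, hcU⟩ := Set.not_subset.1 hnot
  refine ⟨c, fun Q hQ => ⟨fun hcQ => ?_, fun hQS => ?_⟩⟩
  · by_contra hQS
    exact hcU (Set.mem_biUnion (⟨hQ, hQS⟩ : Q ∈ minimalPrimes R \ S) hcQ)
  · exact (Ideal.mem_sInf.1 hc) ⟨hQ, hQS⟩

theorem eq_zero_of_forall_mem_minimalPrimes {R : Type*} [CommRing R] [IsReduced R] {x : R}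
    (h : ∀ Q ∈ minimalPrimes R, x ∈ Q) : x = 0 := by
  have h1 : x ∈ sInf (minimalPrimes R) := Ideal.mem_sInf.2 fun {Q} hQ => h Q hQ
  rw [minimalPrimes, Ideal.sInf_minimalPrimes] at h1
  obtain ⟨n, hn⟩ := h1
  exact IsReduced.eq_zero x ⟨n, hn⟩

open RestrictAlong in
/-- A Cartier map extends to every localization: `x / s ↦ φ (x * s ^ (q - 1)) / s`. -/
theorem IsCartierMap.exists_localization {R A : Type*} [CommRing R] [CommRing A] [Algebra R A]
    (S : Submonoid R) [IsLocalization S A] {p e : ℕ} [hp : Fact p.Prime] [CharP R p] {φ : R →+ R}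
    (hφ : IsCartierMap (p ^ e) φ) : ∃ φ' : A →+ A, IsCartierMap (p ^ e) φ' ∧
      ∀ x, φ' (algebraMap R A x) = algebraMap R A (φ x) := by
  let f := iterateFrobenius R p e
  let g : R →+* A := (algebraMap R A).comp f
  have hg : ∀ r, g r = algebraMap R A r ^ p ^ e := fun r => by
    rw [RingHom.comp_apply, iterateFrobenius_def, map_pow]
  let i : RestrictAlong f R →ₗ[R] RestrictAlong g A :=
    { toFun := fun x => of g A (algebraMap R A ((of f R).symm x))
      map_add' := fun x y => map_add (algebraMap R A) ((of f R).symm x) ((of f R).symm y)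
      map_smul' := fun r x => map_mul (algebraMap R A) (f r) ((of f R).symm x) }
  have hsmul : ∀ (s : S) (y : A), (s : R) • of g A y = of g A (algebraMap R A s ^ p ^ e * y) :=
    fun s y => by rw [smul_of, hg, smul_eq_mul]
  have hu : ∀ s : S, IsUnit (algebraMap R A s) := IsLocalization.map_units A
  have hi : IsLocalizedModule S i :=
    { map_units := fun s => by
        rw [Module.End.isUnit_iff]
        constructor
        · intro x y hxy
          exact ((hu s).pow (p ^ e)).mul_left_cancel
            ((hsmul s ((of g A).symm x)).symm.trans (hxy.trans (hsmul s ((of g A).symm y))))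
        · intro y
          obtain ⟨u, hu'⟩ := (hu s).pow (p ^ e)
          refine ⟨of g A (↑u⁻¹ * (of g A).symm y), (hsmul s _).trans ?_⟩
          rw [← hu', Units.mul_inv_cancel_left]
          rfl
      surj := fun y => by
        obtain ⟨⟨a, s⟩, has⟩ := IsLocalization.surj S ((of g A).symm y)
        obtain ⟨k, hk⟩ := Nat.exists_eq_succ_of_ne_zero (pow_ne_zero e hp.out.ne_zero)
        refine ⟨⟨of f R ((s : R) ^ k * a), s⟩, (hsmul s ((of g A).symm y)).trans ?_⟩
        have : algebraMap R A s ^ p ^ e * (of g A).symm y =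
            algebraMap R A ((s : R) ^ k * a) := by
          rw [hk, pow_succ, map_mul, ← has, map_pow, mul_comm ((of g A).symm y), mul_assoc]
        rw [this]
        rfl
      exists_of_eq := fun {x y} hxy => by
        obtain ⟨s, hs⟩ := IsLocalization.exists_of_eq (M := S) (S := A)
          (show algebraMap R A ((of f R).symm x) = algebraMap R A ((of f R).symm y) from hxy)
        obtain ⟨k, hk⟩ := Nat.exists_eq_succ_of_ne_zero (pow_ne_zero e hp.out.ne_zero)
        refine ⟨s, ?_⟩
        have : ∀ z : R, (s : R) ^ p ^ e * z = (s : R) ^ k * (s * z) := fun z => by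
          rw [hk, pow_succ, mul_assoc]
        have h2 : (s : R) ^ p ^ e * (of f R).symm x = (s : R) ^ p ^ e * (of f R).symm y := by
          rw [this, this, hs]
        exact h2 }
  let φ₀ : RestrictAlong f R →ₗ[R] A :=
    { toFun := fun x => algebraMap R A (φ ((of f R).symm x))
      map_add' := fun x y => by
        rw [← map_add, ← map_add]
        rfl
      map_smul' := fun r x => by
        have := congrArg (algebraMap R A) (hφ r ((of f R).symm x))
        rw [smul_eq_mul, map_mul (algebraMap R A)] at this
        rw [RingHom.id_apply, Algebra.smul_def]
        exact this }
  have hφ₀ : ∀ s : S, IsUnit (algebraMap R (Module.End R A) s) := fun s => by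
    rw [Module.End.isUnit_iff]
    constructor
    · intro x y hxy
      simp only [Module.algebraMap_end_apply, Algebra.smul_def] at hxy
      exact (hu s).mul_left_cancel hxy
    · intro y
      obtain ⟨u, hu'⟩ := hu s
      refine ⟨↑u⁻¹ * y, ?_⟩
      rw [Module.algebraMap_end_apply, Algebra.smul_def, ← hu', Units.mul_inv_cancel_left]
  let ψ := IsLocalizedModule.lift S i φ₀ hφ₀
  have hψ : ∀ x, ψ (i x) = φ₀ x := IsLocalizedModule.lift_apply S i φ₀ hφ₀
  have hψs : ∀ (r : R) (y : A), ψ (of g A (algebraMap R A r ^ p ^ e * y)) =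
      algebraMap R A r * ψ (of g A y) := fun r y => by
    rw [← hg, ← smul_eq_mul, ← smul_of, map_smul, Algebra.smul_def]
  refine ⟨ψ.toAddMonoidHom.comp (of g A).toAddMonoidHom, fun a y => ?_, fun x => hψ (of f R x)⟩
  obtain ⟨r, s, rfl⟩ := IsLocalization.exists_mk'_eq S a
  refine (hu s).mul_left_cancel ?_
  have h1 := hψs s (IsLocalization.mk' A r s ^ p ^ e * y)
  have h2 := hψs r y
  rw [← mul_assoc, ← mul_pow, mul_comm (algebraMap R A s), IsLocalization.mk'_spec, h2] at h1
  refine h1.symm.trans ?_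
  rw [smul_eq_mul, ← mul_assoc, mul_comm (algebraMap R A s), IsLocalization.mk'_spec]
  rfl

/-- Strong F-regularity passes to the local rings. Given `a / s` outside the minimal primes
of `R_P`, let `c` lie in exactly those minimal primes of `R` that are contained in `P`, and `j` in
exactly the others. Then `a * j + c` is in no minimal prime of `R`, and `c` vanishes in `R_P`, so
the Cartier map that sends `a * j + c` to `1` yields one on `R_P` that sends `a / s` to `1`. -/
theorem HasCartierSplittings.localization {R : Type*} [CommRing R] [IsNoetherianRing R] {p : ℕ}
    [Fact p.Prime] [CharP R p] (h : HasCartierSplittings R p) (P : Ideal R) [P.IsPrime] :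
    HasCartierSplittings (Localization.AtPrime P) p := by
  let A := Localization.AtPrime P
  have hred : IsReduced R := h.isReduced
  have hredA : IsReduced A := isReduced_localizationPreserves P.primeCompl A hred
  have hmin : ∀ q : Ideal A, q ∈ minimalPrimes A ↔ q.comap (algebraMap R A) ∈ minimalPrimes R := by
    intro q
    have := IsLocalization.minimalPrimes_map P.primeCompl A (⊥ : Ideal R)
    rw [Ideal.map_bot] at this
    exact Set.ext_iff.1 this q
  intro x hx
  obtain ⟨a, s, rfl⟩ := IsLocalization.exists_mk'_eq P.primeCompl x
  obtain ⟨c, hc⟩ := exists_mem_minimalPrimes_iff {Q : Ideal R | Q ≤ P}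
  obtain ⟨j, hj⟩ := exists_mem_minimalPrimes_iff {Q : Ideal R | Q ≤ P}ᶜ
  have hc0 : algebraMap R A c = 0 := by
    refine eq_zero_of_forall_mem_minimalPrimes fun q hq => ?_
    refine (hc _ ((hmin q).1 hq)).2 ?_
    have hqp : q.IsPrime := hq.1.1
    exact (IsLocalization.AtPrime.under_maximalIdeal A P).subst
      (motive := fun Q => q.comap (algebraMap R A) ≤ Q)
      (Ideal.comap_mono (le_maximalIdeal hqp.ne_top))
  have ha : ∀ Q ∈ minimalPrimes R, Q ≤ P → a ∉ Q := by
    intro Q hQ hQP haQ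
    have hQp : Q.IsPrime := hQ.1.1
    have hcomap : (Q.map (algebraMap R A)).comap (algebraMap R A) = Q :=
      IsLocalization.under_map_of_isPrime_disjoint P.primeCompl A hQp
        (Set.disjoint_left.2 fun y hy hyQ => hy (hQP hyQ))
    refine hx (Q.map (algebraMap R A)) ((hmin _).2 (hcomap.symm ▸ hQ)) ?_
    rw [IsLocalization.mk'_mem_iff]
    exact Ideal.mem_map_of_mem _ haQ
  obtain ⟨e, he, φ, hφ, hφ1⟩ := h (a * j + c) fun Q hQ hmem => by
    have hQp : Q.IsPrime := hQ.1.1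
    by_cases hQP : Q ≤ P
    · have h1 := (Q.add_mem_iff_left ((hc Q hQ).2 hQP)).1 hmem
      exact (hQp.mem_or_mem h1).elim (ha Q hQ hQP) fun hjQ => (hj Q hQ).1 hjQ hQP
    · have h1 := (Q.add_mem_iff_right (Q.mul_mem_left a ((hj Q hQ).2 hQP))).1 hmem
      exact hQP ((hc Q hQ).1 h1)
  obtain ⟨φ', hφ', hφφ'⟩ := hφ.exists_localization (A := A) P.primeCompl
  refine ⟨e, he, φ'.comp (AddMonoidHom.mulRight (algebraMap R A (s * j))), fun r y => ?_, ?_⟩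
  · simp only [AddMonoidHom.comp_apply, AddMonoidHom.mulRight_apply, mul_assoc]
    exact hφ' r _
  · have h2 := hφφ' (a * j + c)
    rw [hφ1, map_one, map_add, hc0, add_zero, map_mul (algebraMap R A)] at h2
    rw [AddMonoidHom.comp_apply, AddMonoidHom.mulRight_apply, map_mul (algebraMap R A),
      ← mul_assoc,
      IsLocalization.mk'_spec]
    exact h2

/-! ### Normality -/

section Normality

variable {A : Type*} [CommRing A] {p : ℕ}

/-- Elements in the tight closure of a principal ideal belong to the ideal. -/
theorem HasCartierSplittings.dvd_of_forall_pow_dvd (h : HasCartierSplittings A p) {a b c : A}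
    (hc : ∀ Q ∈ minimalPrimes A, c ∉ Q) (hab : ∀ e, b ^ p ^ e ∣ a ^ p ^ e * c) : b ∣ a := by
  obtain ⟨e, -, φ, hφ, hφ1⟩ := h c hc
  obtain ⟨r, hr⟩ := hab e
  refine ⟨φ r, ?_⟩
  have h1 := hφ a c
  rw [hr, hφ b r, hφ1, smul_eq_mul, smul_eq_mul, mul_one] at h1
  exact h1.symm

/-- Let `x` lie in one minimal prime `Q₁` only, and `y` in all the others. Then `x * y = 0`, so
`x` is in the tight closure of `(x + y)` and hence `x = (x + y) * r`. As `r` or `1 - r` is a unit,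
`y` or `x` vanishes; the first is impossible, the second says that `Q₁` is the only minimal
prime. -/
theorem HasCartierSplittings.isDomain [IsLocalRing A] [IsNoetherianRing A] [hp : Fact p.Prime]
    (h : HasCartierSplittings A p) : IsDomain A := by
  have hred : IsReduced A := h.isReduced
  obtain ⟨Q₁, hQ₁, -⟩ := Ideal.exists_minimalPrimes_le (bot_le : (⊥ : Ideal A) ≤ maximalIdeal A)
  obtain ⟨x, hx⟩ := exists_mem_minimalPrimes_iff {Q₁}
  obtain ⟨y, hy⟩ := exists_mem_minimalPrimes_iff ({Q₁}ᶜ : Set (Ideal A))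
  have hxy : x * y = 0 := eq_zero_of_forall_mem_minimalPrimes fun Q hQ => by
    by_cases hQQ : Q = Q₁
    · exact Q.mul_mem_right _ ((hx Q hQ).2 hQQ)
    · exact Q.mul_mem_left _ ((hy Q hQ).2 hQQ)
  have hsum : ∀ Q ∈ minimalPrimes A, x + y ∉ Q := fun Q hQ hmem => by
    by_cases hQQ : Q = Q₁
    · exact (hy Q hQ).1 ((Q.add_mem_iff_right ((hx Q hQ).2 hQQ)).1 hmem) hQQ
    · exact hQQ ((hx Q hQ).1 ((Q.add_mem_iff_left ((hy Q hQ).2 hQQ)).1 hmem))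
  have hpow : ∀ n, x * (x + y) ^ n = x ^ (n + 1) := fun n => by
    induction n with
    | zero => ring
    | succ n ih => rw [pow_succ, ← mul_assoc, ih, mul_add, pow_succ x n, mul_assoc _ x y, hxy]; ring
  obtain ⟨r, hr⟩ : x + y ∣ x := h.dvd_of_forall_pow_dvd hsum fun e => ⟨x, by
    obtain ⟨k, hk⟩ := Nat.exists_eq_succ_of_ne_zero (pow_ne_zero e hp.out.ne_zero)
    rw [mul_comm _ x, hpow, hk, mul_add, Nat.succ_eq_add_one, pow_succ x k, mul_assoc _ x y, hxy]
    ring⟩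
  have hry : r * y ^ 2 = 0 := by linear_combination (1 - r) * hxy - y * hr
  have hrx : (1 - r) * x ^ 2 = 0 := by linear_combination x * hr + r * hxy
  have hQ₁p : Q₁.IsPrime := hQ₁.1.1
  rcases isUnit_or_isUnit_one_sub_self r with hu | hu
  · have hy0 := eq_zero_of_pow_eq_zero (hu.mul_right_eq_zero.1 hry)
    exact absurd rfl ((hy Q₁ hQ₁).1 (hy0 ▸ Q₁.zero_mem))
  · have hx0 := eq_zero_of_pow_eq_zero (hu.mul_right_eq_zero.1 hrx)
    have hbot : Q₁ = ⊥ := by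
      rw [eq_bot_iff]
      intro z hz
      refine eq_zero_of_forall_mem_minimalPrimes fun Q hQ => ?_
      have : Q = Q₁ := (hx Q hQ).1 (hx0 ▸ Q.zero_mem)
      exact this ▸ hz
    rw [hbot] at hQ₁p
    exact IsDomain.of_bot_isPrime A

theorem HasCartierSplittings.exists_apply_eq_one [IsDomain A] (h : HasCartierSplittings A p)
    {c : A} (hc : c ≠ 0) : ∃ (e : ℕ) (φ : A →+ A), IsCartierMap (p ^ e) φ ∧ φ c = 1 := by
  obtain ⟨e, -, h⟩ := h c fun Q hQ hcQ => hc (by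
    rw [IsDomain.minimalPrimes_eq_singleton_bot] at hQ
    rw [Set.mem_singleton_iff.1 hQ] at hcQ
    exact hcQ)
  exact ⟨e, h⟩

theorem HasCartierSplittings.isIntegrallyClosed [IsDomain A] (h : HasCartierSplittings A p) :
    IsIntegrallyClosed A := by
  rw [isIntegrallyClosed_iff (FractionRing A)]
  intro x hx
  obtain ⟨c, hc, hcx⟩ := hx.isAlmostIntegral
  obtain ⟨a, b, rfl⟩ := IsLocalization.exists_mk'_eq (nonZeroDivisors A) x
  have hdvd : (b : A) ∣ a := by
    refine h.dvd_of_forall_pow_dvd (c := c) (fun Q hQ hcQ => ?_) fun e => ?_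
    · rw [IsDomain.minimalPrimes_eq_singleton_bot] at hQ
      rw [Set.mem_singleton_iff.1 hQ] at hcQ
      exact nonZeroDivisors.ne_zero hc hcQ
    · obtain ⟨s, hs⟩ := hcx (p ^ e)
      refine ⟨s, IsFractionRing.injective A (FractionRing A) ?_⟩
      have hb := IsLocalization.mk'_spec (FractionRing A) a b
      rw [map_mul, map_mul, hs, Algebra.smul_def, map_pow, map_pow, ← hb]
      ring
  obtain ⟨r, hr⟩ := hdvd
  refine ⟨r, ?_⟩
  rw [IsLocalization.eq_mk'_iff_mul_eq, ← map_mul, hr, mul_comm]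

end Normality

/-! ### Free quotients of the Frobenius pushforwards -/

section FreeQuotients

variable {A : Type*} [CommRing A] {p : ℕ} [hp : Fact p.Prime] [CharP A p]

/-- For an F-finite domain with fraction field `K` there is a single `c ≠ 0` such that, for every
`e`, some `A`-linear map from `F^e_* A` to a free module of rank `[K : K ^ p] ^ e` has cokernel
killed by `c`. -/
theorem IsFFinite.exists_uniform_cartierMap (K : Type*) [IsDomain A] [Field K] [Algebra A K]
    [IsFractionRing A K] [CharP K p] (hA : IsFFinite A p) :
    ∃ c : A, c ≠ 0 ∧ ∀ e : ℕ, ∃ (ι : Type) (_ : Fintype ι) (_ : DecidableEq ι) (ψ : A →+ (ι → A)),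
      (Fintype.card ι : ℕ∞) = frobeniusDegree K p ^ e ∧ IsCartierMap (p ^ e) ψ ∧
        ∀ i, ∃ y, ψ y = Pi.single i c := by
  obtain ⟨n, ψ₁, c, hn, -, hc, hψ₁⟩ := hA.exists_injective_linearMap K
  let ψ : A →+ (Fin n → A) :=
    ψ₁.toAddMonoidHom.comp (RestrictAlong.of (frobenius A p) A).toAddMonoidHom
  have hψ : IsCartierMap p ψ := fun r x => ψ₁.map_smul r (RestrictAlong.of (frobenius A p) A x)
  have hψc : ∀ j, ∃ y, ψ y = Pi.single j c := hψ₁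
  -- The square of `c` works for all `e` at once because it divides `c ^ p`.
  refine ⟨c ^ 2, pow_ne_zero 2 hc, fun e => ?_⟩
  induction e with
  | zero =>
    refine ⟨Unit, inferInstance, inferInstance, ⟨⟨fun x _ => x, rfl⟩, fun _ _ => rfl⟩, by simp,
      fun r x => ?_, fun i => ⟨c ^ 2, ?_⟩⟩
    · ext
      simp
    · ext
      simp
  | succ e ih =>
    obtain ⟨ι, _, _, ψe, hcard, hψe, hy⟩ := ih
    refine ⟨ι × Fin n, inferInstance, inferInstance,
      ⟨⟨fun x ij => ψ (ψe x ij.1) ij.2, ?_⟩, fun x y => ?_⟩, ?_, fun r x => ?_, fun ij => ?_⟩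
    · ext ij
      simp
    · ext ij
      simp
    · rw [Fintype.card_prod, Nat.cast_mul, hcard, Fintype.card_fin, pow_succ, hn]
    · ext ij
      have h1 : ψe (r ^ p ^ (e + 1) * x) = r ^ p • ψe x := by
        rw [← hψe, ← pow_mul, ← pow_succ']
      simp only [AddMonoidHom.coe_mk, ZeroHom.coe_mk, Pi.smul_apply, h1, smul_eq_mul, hψ r]
    · obtain ⟨i, j⟩ := ij
      obtain ⟨y, hy⟩ := hy i
      obtain ⟨z, hz⟩ := hψc j
      obtain ⟨k, hk⟩ := Nat.exists_eq_add_of_le hp.out.two_le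
      refine ⟨(c ^ k * z) ^ p ^ e * y, ?_⟩
      have h1 : ψe ((c ^ k * z) ^ p ^ e * y) = Pi.single i (c ^ p * z) := by
        rw [hψe, hy, ← Pi.single_smul, smul_eq_mul, hk]
        congr 1
        ring
      have h2 : ψ (c ^ p * z) = Pi.single j (c ^ 2) := by
        rw [hψ, hz, ← Pi.single_smul, smul_eq_mul, sq]
      ext ⟨i', j'⟩
      simp only [AddMonoidHom.coe_mk, ZeroHom.coe_mk, h1]
      by_cases hi : i' = i
      · subst hi
        rw [Pi.single_eq_same, h2]
        by_cases hj : j' = j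
        · subst hj
          simp
        · rw [Pi.single_eq_of_ne hj, Pi.single_eq_of_ne (by simp [hj])]
      · rw [Pi.single_eq_of_ne hi, map_zero, Pi.single_eq_of_ne (by simp [hi])]
        rfl

/-- If every nonzero element is sent to `1` by a Cartier map, then `F^(e + e₀)_* A` surjects onto
a free module of rank `[K : K ^ p] ^ e`, with `e₀` independent of `e`. -/
theorem HasCartierSplittings.exists_free_quotients (K : Type*) [IsDomain A] [Field K]
    [Algebra A K] [IsFractionRing A K] [CharP K p] (h : HasCartierSplittings A p)
    (hA : IsFFinite A p) :
    ∃ e₀ : ℕ, ∀ e : ℕ, ∃ (ι : Type) (_ : Fintype ι) (_ : DecidableEq ι) (ψ : A →+ (ι → A)),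
      (Fintype.card ι : ℕ∞) = frobeniusDegree K p ^ e ∧ IsCartierMap (p ^ (e + e₀)) ψ ∧
        ∀ i, ∃ y, ψ y = Pi.single i 1 := by
  obtain ⟨c, hc, hψ⟩ := hA.exists_uniform_cartierMap K
  obtain ⟨e₀, φ, hφ, hφ1⟩ := h.exists_apply_eq_one hc
  refine ⟨e₀, fun e => ?_⟩
  obtain ⟨ι, _, _, ψ, hcard, hψ, hy⟩ := hψ e
  refine ⟨ι, inferInstance, inferInstance, (φ.compLeft ι).comp ψ, hcard, fun r x => ?_,
    fun i => ?_⟩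
  · have h1 : ψ (r ^ p ^ (e + e₀) * x) = r ^ p ^ e₀ • ψ x := by
      rw [← hψ, ← pow_mul, ← pow_add, add_comm]
    ext i
    simp only [AddMonoidHom.comp_apply, AddMonoidHom.compLeft_apply, Function.comp_apply, h1,
      Pi.smul_apply, smul_eq_mul, hφ r]
  · obtain ⟨y, hy⟩ := hy i
    refine ⟨y, ?_⟩
    ext j
    simp only [AddMonoidHom.comp_apply, AddMonoidHom.compLeft_apply, Function.comp_apply, hy]
    by_cases hj : j = i
    · subst hj
      simp [hφ1]
    · simp [Pi.single_eq_of_ne hj]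

open RestrictAlong in
/-- A surjective Cartier map to a free module splits, and the splitting stays injective modulo
an ideal `I` and its Frobenius power. -/
theorem IsCartierMap.exists_injective_quotient {e : ℕ} {ι : Type*} [Fintype ι] [DecidableEq ι]
    {ψ : A →+ (ι → A)} (hψ : IsCartierMap (p ^ e) ψ) (hy : ∀ i, ∃ y, ψ y = Pi.single i 1)
    (I : Ideal A) :
    ∃ σ : (ι → A ⧸ I) →ₗ[A]
        RestrictAlong (iterateFrobenius A p e) (A ⧸ I.map (iterateFrobenius A p e)),
      Function.Injective σ := by
  choose y hy using hy
  let f := iterateFrobenius A p e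
  let J := I.map f
  let σ₀ : (ι → A) →ₗ[A] RestrictAlong f (A ⧸ J) :=
    Fintype.linearCombination A fun i => of f (A ⧸ J) (Ideal.Quotient.mk J (y i))
  have hσ₀ : ∀ v, σ₀ v = of f (A ⧸ J) (Ideal.Quotient.mk J (∑ i, v i ^ p ^ e * y i)) := by
    intro v
    rw [Fintype.linearCombination_apply, map_sum, map_sum]
    exact Finset.sum_congr rfl fun i _ => rfl
  have hψσ : ∀ v : ι → A, ψ (∑ i, v i ^ p ^ e * y i) = v := by
    intro v
    rw [map_sum]
    simp_rw [hψ _ _, hy]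
    ext j
    simp [Finset.sum_apply, Pi.single_apply]
  have hψJ : ∀ z ∈ J, ∀ a i, ψ (a * z) i ∈ I := by
    intro z hz
    refine Submodule.span_induction (p := fun z _ => ∀ a i, ψ (a * z) i ∈ I) ?_ ?_ ?_ ?_ hz
    · rintro _ ⟨r, hr, rfl⟩ a i
      have h1 : a * f r = r ^ p ^ e * a := mul_comm _ _
      change ψ (a * f r) i ∈ I
      rw [h1, hψ]
      exact I.mul_mem_right _ hr
    · intro a i
      simp
    · intro z w _ _ hz hw a i
      rw [mul_add, map_add]
      exact I.add_mem (hz a i) (hw a i)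
    · intro b z _ hz a i
      rw [smul_eq_mul, ← mul_assoc]
      exact hz _ i
  let π : (ι → A) →ₗ[A] (ι → A ⧸ I) := LinearMap.compLeft (Submodule.mkQ I) ι
  have hπ : Function.Surjective π := (Submodule.mkQ_surjective I).comp_left
  have hker : LinearMap.ker π = LinearMap.ker σ₀ := by
    ext v
    have h1 : v ∈ LinearMap.ker π ↔ ∀ i, v i ∈ I := by
      rw [LinearMap.mem_ker, funext_iff]
      exact forall_congr' fun i => Submodule.Quotient.mk_eq_zero I
    have h2 : v ∈ LinearMap.ker σ₀ ↔ (∑ i, v i ^ p ^ e * y i) ∈ J := by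
      rw [LinearMap.mem_ker, hσ₀]
      exact Ideal.Quotient.eq_zero_iff_mem
    rw [h1, h2]
    constructor
    · intro hv
      exact J.sum_mem fun i _ => J.mul_mem_right _ (Ideal.mem_map_of_mem f (hv i))
    · intro hv i
      have := hψJ _ hv 1 i
      rwa [one_mul, hψσ] at this
  refine ⟨(LinearMap.ker π).liftQ σ₀ hker.le ∘ₗ
    (π.quotKerEquivOfSurjective hπ).symm.toLinearMap, ?_⟩
  have hinj : Function.Injective ((LinearMap.ker π).liftQ σ₀ hker.le) := by
    rw [← LinearMap.ker_eq_bot, Submodule.ker_liftQ_eq_bot']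
    exact hker
  exact hinj.comp (π.quotKerEquivOfSurjective hπ).symm.injective

end FreeQuotients

/-! ### The Cohen–Macaulay property -/

section CohenMacaulay

open RingTheory.Sequence

variable {A : Type*} [CommRing A] {p : ℕ} [hp : Fact p.Prime] [CharP A p]

/-- If a regular sequence `rs` is shorter than the dimension, the maximal ideal is not associated
to `A / (rs)`: otherwise a free summand of rank `[K : K ^ p] ^ e` of `F^(e + e₀)_* A` yields
`[K : K ^ p] ^ e` independent copies of the residue field in `F^(e + e₀)_* (A / (rs ^ q))`,
`q = p ^ (e + e₀)`, where there is only room for a constant times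
`(p ^ rs.length * [k : k ^ p]) ^ (e + e₀)` of them. -/
theorem HasCartierSplittings.maximalIdeal_notMem_associatedPrimes [IsLocalRing A] [IsDomain A]
    [IsNoetherianRing A] (h : HasCartierSplittings A p) (hA : IsFFinite A p) {d : ℕ}
    (hd : ringKrullDim A = d) (rs : List A) (hrs : IsWeaklyRegular A rs) (hlen : rs.length < d) :
    maximalIdeal A ∉ associatedPrimes A (A ⧸ Ideal.ofList rs) := by
  intro hass
  have : CharP (ResidueField A) p := charP_of_ringHom p (residue A)
  have : CharP (FractionRing A) p := charP_of_ringHom p (algebraMap A (FractionRing A))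
  have hdim := pow_mul_frobeniusDegree_residueField_le d A hA hd
  have hk : IsFFinite (ResidueField A) p := hA.of_surjective (residue A) residue_surjective
  have hK : IsFFinite (FractionRing A) p := hA.of_isLocalization (nonZeroDivisors A)
  obtain ⟨α, hα⟩ : ∃ α : ℕ, frobeniusDegree (ResidueField A) p = α := ⟨_, hk.frobeniusDegree_eq⟩
  obtain ⟨D, hD⟩ : ∃ D : ℕ, frobeniusDegree (FractionRing A) p = D := ⟨_, hK.frobeniusDegree_eq⟩
  obtain ⟨C, hC⟩ : ∃ C : ℕ, socleLength A (A ⧸ Ideal.ofList rs) = C :=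
    ⟨_, (ENat.natCast_toNat socleLength_ne_top).symm⟩
  have hα0 : 0 < α := by
    rw [Nat.pos_iff_ne_zero]
    rintro rfl
    exact frobeniusDegree_ne_zero (ResidueField A) hα
  rw [hα, hD] at hdim
  norm_cast at hdim
  let β := p ^ rs.length * α
  have hβ : 0 < β := Nat.mul_pos (pow_pos hp.out.pos _) hα0
  have hpβ : p * β ≤ D := by
    refine le_trans ?_ hdim
    rw [← mul_assoc, ← pow_succ']
    exact Nat.mul_le_mul_right _ (Nat.pow_le_pow_right hp.out.pos hlen)
  obtain ⟨e₀, hfree⟩ := h.exists_free_quotients (FractionRing A) hA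
  have key : ∀ e, D ^ e ≤ β ^ (e + e₀) * C := by
    intro e
    obtain ⟨ι, _, _, ψ, hcard, hψ, hy⟩ := hfree e
    have hloc : IsLocalHom (iterateFrobenius A p (e + e₀)) := isLocalHom_iterateFrobenius A _
    obtain ⟨σ, hσ⟩ := hψ.exists_injective_quotient hy (Ideal.ofList rs)
    have h1 := (natCard_le_socleLength_pi ι hass).trans (socleLength_le_of_injective σ hσ)
    have h2 := h1.trans (socleLength_restrictAlong_le _ (hA.iterateFrobenius_finite _) _)
    have hmap : (Ideal.ofList rs).map (iterateFrobenius A p (e + e₀)) =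
        Ideal.ofList (rs.map (· ^ p ^ (e + e₀))) := by
      rw [Ideal.map_ofList]
      rfl
    have h3 := socleLength_quotient_map_pow_le A rs hrs (p ^ (e + e₀))
    rw [smul_eq_mul, smul_eq_mul, Ideal.mul_top, Ideal.mul_top, ← hmap, hC] at h3
    rw [lengthAlong_residueFieldMap_iterateFrobenius, hα, hcard, hD] at h2
    have h4 := h2.trans (mul_le_mul_left h3 _)
    norm_cast at h4
    refine h4.trans (le_of_eq ?_)
    simp only [β]
    rw [mul_pow, ← pow_mul, ← pow_mul, mul_comm rs.length]
    ring
  -- `(p * β) ^ e ≤ β ^ (e + e₀) * C` bounds `p ^ e` independently of `e`.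
  have hbound : ∀ e, p ^ e ≤ β ^ e₀ * C := fun e => by
    have h1 := (Nat.pow_le_pow_left hpβ e).trans (key e)
    rw [mul_pow, mul_comm, pow_add, mul_assoc] at h1
    exact Nat.le_of_mul_le_mul_left h1 (pow_pos hβ e)
  exact absurd (hbound (β ^ e₀ * C)) (not_le.2 (Nat.lt_pow_self hp.out.one_lt))

theorem exists_isSMulRegular_of_maximalIdeal_notMem {M : Type*} [AddCommGroup M] [Module A M]
    [IsLocalRing A] [IsNoetherianRing A] [Module.Finite A M]
    (h : maximalIdeal A ∉ associatedPrimes A M) : ∃ x ∈ maximalIdeal A, IsSMulRegular M x := by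
  by_contra! hx
  have hsub : (maximalIdeal A : Set A) ⊆ ⋃ P ∈ associatedPrimes A M, (id P : Ideal A) := by
    have := biUnion_associatedPrimes_eq_compl_regular A M
    intro x hxm
    exact this.symm ▸ hx x hxm
  obtain ⟨P, hP, hle⟩ := (Ideal.subset_union_prime_finite (associatedPrimes.finite A M)
    (maximalIdeal A) (maximalIdeal A) fun P hP _ _ => hP.1).1 hsub
  have : maximalIdeal A = P := (maximalIdeal.isMaximal A).eq_of_le hP.1.ne_top hle
  exact h (this ▸ hP)

theorem HasCartierSplittings.isCohenMacaulayLocalRing [IsLocalRing A] [IsNoetherianRing A]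
    (h : HasCartierSplittings A p) (hA : IsFFinite A p) : IsCohenMacaulayLocalRing A := by
  have : IsDomain A := h.isDomain
  obtain ⟨d, hd⟩ : ∃ d : ℕ, ringKrullDim A = d := by
    obtain ⟨b, hb⟩ := WithBot.ne_bot_iff_exists.1 (ringKrullDim_ne_bot (R := A))
    obtain ⟨d, rfl⟩ := ENat.ne_top_iff_exists.1 fun hb' : b = ⊤ =>
      ringKrullDim_ne_top (R := A) (by rw [← hb, hb']; rfl)
    exact ⟨d, hb.symm⟩
  have key : ∀ k ≤ d, ∃ rs : List A, rs.length = k ∧ (∀ r ∈ rs, r ∈ maximalIdeal A) ∧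
      IsWeaklyRegular A rs := by
    intro k
    induction k with
    | zero => exact fun _ => ⟨[], rfl, by simp, IsWeaklyRegular.nil A A⟩
    | succ k ih =>
      intro hk
      obtain ⟨rs, hlen, hmem, hrs⟩ := ih (Nat.le_of_succ_le hk)
      obtain ⟨x, hxm, hx⟩ := exists_isSMulRegular_of_maximalIdeal_notMem
        (h.maximalIdeal_notMem_associatedPrimes hA hd rs hrs (hlen ▸ hk))
      refine ⟨rs ++ [x], by simp [hlen], ?_, ?_⟩
      · intro r hr
        rcases List.mem_append.1 hr with hr | hr
        · exact hmem r hr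
        · rw [List.mem_singleton.1 hr]
          exact hxm
      · rw [isWeaklyRegular_append_iff, isWeaklyRegular_singleton_iff, smul_eq_mul, Ideal.mul_top]
        exact ⟨hrs, hx⟩
  obtain ⟨rs, hlen, hmem, hrs⟩ := key d le_rfl
  exact ⟨rs, IsRegular.of_isWeaklyRegular_of_mem_maximalIdeal A hmem hrs, by rw [hlen, hd]⟩

end CohenMacaulay

theorem mainTheorem2 (p : ℕ) [Fact p.Prime] (R : Type*) [CommRing R] [CharP R p]
    [IsNoetherianRing R] (hR : IsStronglyFRegular R p) :
    IsCohenMacaulayRing R ∧ IsNormalRing R := by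
  have hloc : ∀ (P : Ideal R) [P.IsPrime], HasCartierSplittings (Localization.AtPrime P) p :=
    fun P _ => hR.hasCartierSplittings.localization P
  refine ⟨⟨inferInstance, fun P _ => ?_⟩, fun P _ => ?_⟩
  · have : CharP (Localization.AtPrime P) p := charP_of_ringHom p (algebraMap R _)
    exact (hloc P).isCohenMacaulayLocalRing (hR.1.of_isLocalization P.primeCompl)
  · have := (hloc P).isDomain
    exact ⟨this, (hloc P).isIntegrallyClosed⟩
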